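/- Let $M$ be a (Hausdorff) smooth manifold of dimension $p+q$ with a smooth foliation $\mathcal F$ whose leaves have dimension $p$, and let $N=TM/T\mathcal F$ be its normal bundle, $\bar X$ denoting the section of $N$ defined by a vector field $X$. An adapted chart is a smooth chart $(x^1,\dots,x^p,y^1,\dots,y^q)$ in which $T\mathcal F$ is spanned by the $\partial/\partial x^a$; we write $\partial_i$ for the section $\overline{\partial/\partial y^i}$ of $N$. A function is basic if it is smooth and constant along the leaves (its derivative along $T\mathcal F$ vanishes); a section of $N$ over an open set is foliated if its components in adapted charts are basic; a vector field is an infinitesimal automorphism if it is smooth and its class in $N$ is foliated. A connection $D$ in $N$ is foliated if, for every local foliated section $s$, $D_Xs=0$ for $X\in T\mathcal F$ and $D_Xs$ is foliated for every infinitesimal automorphism $X$. It is torsion-free if $D_X\bar Y-D_Y\bar X=\overline{[X,Y]}$ for all local smooth vector fields $X,Y$, and flat if it is torsion-free and its curvature vanishes. A Riemannian metric $g$ in $N$ is foliated if $g(Y,Z)$ is basic for all local foliated sections $Y,Z$. Assume that $\mathcal F$ is transversely affine, with foliated flat connection $D$ in $N$, and that $g$ is a foliated metric. Let $\nabla$ be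 the Levi-Civita connection of $g$, i.e. the torsion-free connection in $N$ with $\nabla g=0$, and let $\gamma=\nabla-D$. An adapted chart is called affine if $D\partial_i=0$ for $i=1,\dots,q$. For an adapted chart put $g_{ij}=g(\partial_i,\partial_j)$, $\gamma_{\partial_j}\partial_k=\sum_s\gamma^s_{jk}\partial_s$ and $\gamma_{ijk}=\sum_s g_{is}\gamma^s_{jk}$. For an open set $W\subseteq M$ and an adapted chart $(U,\varphi)$ consider the conditions, where $i,j,k$ run from $1$ to $q$: (i)$_W$ $g$ is a foliated Hessian metric on $W$: around every point of $W$ there are an affine adapted chart and a basic function $h$ on its domain with $g_{ij}=\dfrac{\partial^2h}{\partial y^i\partial y^j}$ in that chart; (ii)$_W$ $(D_Xg)(Y,Z)=(D_Yg)(X,Z)$ for all foliated sections $X,Y,Z$ of $N$ over open subsets of $W$; (iii)$_\varphi$ $\dfrac{\partial g_{ij}}{\partial y^k}=\dfrac{\partial g_{kj}}{\partial y^i}$ on $U$; (iv)$_W$ $g(\gamma_XY,Z)=g(Y,\gamma_XZ)$ for all foliated sections $X,Y,Z$ of $N$ over open subsets of $W$; (v)$_\varphi$ $\gamma_{ijk}=\gamma_{jik}$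 on $U$. Then: for every adapted chart $(U,\varphi)$ the conditions (i)$_U$, (ii)$_U$, (iv)$_U$, (v)$_\varphi$ are equivalent; for every affine adapted chart $(U,\varphi)$ the five conditions (i)$_U$, (ii)$_U$, (iii)$_\varphi$, (iv)$_U$, (v)$_\varphi$ are equivalent; and (i)$_M$, (ii)$_M$, (iii)$_\varphi$ for all affine adapted charts $\varphi$, (iv)$_M$, and (v)$_\varphi$ for all adapted charts $\varphi$ are equivalent. -/

import Mathlib

open scoped Manifold ContDiff Topology

noncomputable section

/-- The model space `ℝᵖ × ℝ^q`; points are written `(x, y)`, with `x` the leaf coordinates and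
`y` the transverse coordinates. -/
abbrev FolModel (p q : ℕ) : Type := EuclideanSpace ℝ (Fin p) × EuclideanSpace ℝ (Fin q)

/-- The (boundaryless) model with corners on `ℝᵖ × ℝ^q`. -/
abbrev folI (p q : ℕ) : ModelWithCorners ℝ (FolModel p q) (FolModel p q) := 𝓘(ℝ, FolModel p q)

/-- The differential `dy_x : T_x M → ℝ^q` of the transverse part `y = (e ·).2` of a chart `e`. -/
def transDiff {p q : ℕ} {M : Type*} [TopologicalSpace M] [ChartedSpace (FolModel p q) M]
    (e : OpenPartialHomeomorph M (FolModel p q)) (x : M) :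
    TangentSpace (folI p q) x →ₗ[ℝ] EuclideanSpace ℝ (Fin q) :=
  (mfderiv (folI p q) 𝓘(ℝ, EuclideanSpace ℝ (Fin q)) (fun z => (e z).2) x).toLinearMap

/-- A chart `e` of the smooth manifold `M` is adapted to the distribution `T` if on its domain `T`
is the kernel of `dy¹, …, dy^q`, i.e. is spanned by `∂/∂x¹, …, ∂/∂xᵖ`. -/
def IsAdaptedTo {p q : ℕ} {M : Type*} [TopologicalSpace M] [ChartedSpace (FolModel p q) M]
    [IsManifold (folI p q) ∞ M] (T : ∀ x : M, Submodule ℝ (TangentSpace (folI p q) x))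
    (e : OpenPartialHomeomorph M (FolModel p q)) : Prop :=
  e ∈ IsManifold.maximalAtlas (folI p q) ∞ M ∧ ∀ x ∈ e.source, T x = LinearMap.ker (transDiff e x)

/-- A smooth foliation of codimension `q`, with leaves of dimension `p`, on the manifold `M` of
dimension `p + q`, given by its tangent distribution `TF`: every point lies in an adapted chart. -/
structure Foliation (p q : ℕ) (M : Type*) [TopologicalSpace M] [ChartedSpace (FolModel p q) M]
    [IsManifold (folI p q) ∞ M] where
  tangent : ∀ x : M, Submodule ℝ (TangentSpace (folI p q) x)
  exists_adapted : ∀ x : M, ∃ e : OpenPartialHomeomorph M (FolModel p q),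
    x ∈ e.source ∧ IsAdaptedTo tangent e

/-- `X` is a smooth vector field on `V`. -/
def SmoothFieldOn {p q : ℕ} {M : Type*} [TopologicalSpace M] [ChartedSpace (FolModel p q) M]
    [IsManifold (folI p q) ∞ M] (X : ∀ x : M, TangentSpace (folI p q) x) (V : Set M) : Prop :=
  ContMDiffOn (folI p q) (folI p q).tangent ∞
    (fun x => (⟨x, X x⟩ : TangentBundle (folI p q) M)) V

/-- `f` is a smooth function on `V`. -/
def SmoothFunOn {p q : ℕ} {M : Type*} [TopologicalSpace M] [ChartedSpace (FolModel p q) M]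
    (f : M → ℝ) (V : Set M) : Prop :=
  ContMDiffOn (folI p q) 𝓘(ℝ, ℝ) ∞ f V

/-- The differential `df_x : T_x M → ℝ` of a function. -/
def funDiff {p q : ℕ} {M : Type*} [TopologicalSpace M] [ChartedSpace (FolModel p q) M]
    (f : M → ℝ) (x : M) : TangentSpace (folI p q) x →ₗ[ℝ] ℝ :=
  (mfderiv (folI p q) 𝓘(ℝ, ℝ) f x).toLinearMap

/-- The partial derivative `∂f/∂yⁱ` in the chart `e`. -/
def partialY {p q : ℕ} {M : Type*} [TopologicalSpace M]
    (e : OpenPartialHomeomorph M (FolModel p q)) (f : M → ℝ) (i : Fin q) (x : M) : ℝ :=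
  fderiv ℝ (fun w => f (e.symm w)) (e x) (0, EuclideanSpace.single i 1)

/-- The coordinate vector field `∂/∂yⁱ` of the chart `e` (used on `e.source` only). -/
def coordVec {p q : ℕ} {M : Type*} [TopologicalSpace M] [ChartedSpace (FolModel p q) M]
    (e : OpenPartialHomeomorph M (FolModel p q)) (i : Fin q) (x : M) :
    TangentSpace (folI p q) x :=
  (mfderiv (folI p q) (folI p q) e x).inverse
    ((0, EuclideanSpace.single i 1) : FolModel p q)

namespace Foliation

variable {p q : ℕ} {M : Type*} [TopologicalSpace M] [ChartedSpace (FolModel p q) M]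
  [IsManifold (folI p q) ∞ M]

/-- The adapted charts of the foliation. -/
def IsAdapted (F : Foliation p q M) (e : OpenPartialHomeomorph M (FolModel p q)) : Prop :=
  IsAdaptedTo F.tangent e

/-- The fibre at `x` of the normal bundle `N(M, F) = TM / TF`. -/
abbrev Normal (F : Foliation p q M) (x : M) : Type :=
  TangentSpace (folI p q) x ⧸ F.tangent x

/-- The class in the normal bundle of a tangent vector. -/
def bar (F : Foliation p q M) (x : M) : TangentSpace (folI p q) x →ₗ[ℝ] F.Normal x :=
  (F.tangent x).mkQ

/-- The section of the normal bundle determined by `∂/∂yⁱ`. -/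
def coordSection (F : Foliation p q M) (e : OpenPartialHomeomorph M (FolModel p q)) (i : Fin q)
    (x : M) : F.Normal x :=
  F.bar x (coordVec e i x)

open Classical in
/-- The components `(dy¹(s), …, dy^q(s))` of a normal vector `s` in an adapted chart `e`:
the map induced by `dy` on `TM / TF` (it is only used over the domain of an adapted chart, where
`dy` vanishes on `TF`). -/
def coeff (F : Foliation p q M) (e : OpenPartialHomeomorph M (FolModel p q)) (x : M) :
    F.Normal x →ₗ[ℝ] EuclideanSpace ℝ (Fin q) :=
  if h : F.tangent x ≤ LinearMap.ker (transDiff e x) then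
    (F.tangent x).liftQ (transDiff e x) h
  else 0

/-- A smooth function that is constant along the leaves (locally a function of `y` only). -/
def IsBasicOn (F : Foliation p q M) (f : M → ℝ) (V : Set M) : Prop :=
  SmoothFunOn (p := p) (q := q) f V ∧
    ∀ x ∈ V, ∀ v ∈ F.tangent x, funDiff (p := p) (q := q) f x v = 0

/-- `s` is a smooth section of the normal bundle over `V`: its components in adapted charts are
smooth. -/
def IsSmoothOn (F : Foliation p q M) (s : ∀ x, F.Normal x) (V : Set M) : Prop :=
  ∀ e, F.IsAdapted e → ∀ i : Fin q,
    SmoothFunOn (p := p) (q := q) (fun x => F.coeff e x (s x) i) (V ∩ e.source)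

/-- `s` is a foliated section of the normal bundle over `V`: its components in adapted charts are
basic functions. -/
def IsFoliatedOn (F : Foliation p q M) (s : ∀ x, F.Normal x) (V : Set M) : Prop :=
  ∀ e, F.IsAdapted e → ∀ i : Fin q,
    F.IsBasicOn (fun x => F.coeff e x (s x) i) (V ∩ e.source)

/-- `X` is an infinitesimal automorphism of the foliation (a foliated vector field) over `V`. -/
def IsInfAutOn (F : Foliation p q M) (X : ∀ x : M, TangentSpace (folI p q) x) (V : Set M) : Prop :=
  SmoothFieldOn X V ∧ F.IsFoliatedOn (fun x => F.bar x (X x)) V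

/-- A smooth linear connection in the normal bundle: `D s x v` is `D_v s` for `v ∈ T_x M`.
The connection acts on the smooth sections over arbitrary open sets, compatibly with restriction;
its values on sections that are not smooth near `x` carry no information. -/
structure NormalConnection (F : Foliation p q M) where
  toFun : (∀ x, F.Normal x) → ∀ x, TangentSpace (folI p q) x →ₗ[ℝ] F.Normal x
  congr' : ∀ {V : Set M} {s t : ∀ x, F.Normal x}, IsOpen V → F.IsSmoothOn s V →
    (∀ x ∈ V, s x = t x) → ∀ x ∈ V, toFun s x = toFun t x
  add' : ∀ {V : Set M} {s t : ∀ x, F.Normal x}, IsOpen V → F.IsSmoothOn s V → F.IsSmoothOn t V →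
    ∀ x ∈ V, toFun (fun z => s z + t z) x = toFun s x + toFun t x
  leibniz' : ∀ {V : Set M} {f : M → ℝ} {s : ∀ x, F.Normal x}, IsOpen V →
    SmoothFunOn (p := p) (q := q) f V → F.IsSmoothOn s V → ∀ x ∈ V, ∀ v,
      toFun (fun z => f z • s z) x v = f x • toFun s x v + funDiff (p := p) (q := q) f x v • s x
  smooth' : ∀ {V : Set M} {X : ∀ x : M, TangentSpace (folI p q) x} {s : ∀ x, F.Normal x},
    IsOpen V → SmoothFieldOn X V → F.IsSmoothOn s V →
      F.IsSmoothOn (fun x => toFun s x (X x)) V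

/-- A (smooth, positive definite) Riemannian metric in the normal bundle. -/
structure NormalMetric (F : Foliation p q M) where
  toFun : ∀ x, F.Normal x →ₗ[ℝ] F.Normal x →ₗ[ℝ] ℝ
  symm' : ∀ x u v, toFun x u v = toFun x v u
  pos' : ∀ x v, v ≠ 0 → 0 < toFun x v v
  smooth' : ∀ {V : Set M} {s t : ∀ x, F.Normal x}, IsOpen V → F.IsSmoothOn s V →
    F.IsSmoothOn t V → SmoothFunOn (p := p) (q := q) (fun x => toFun x (s x) (t x)) V

/-- The metric is foliated: `g(Y, Z)` is basic for all local foliated sections `Y`, `Z`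
(equivalently `g = ∑ g_ij(y) dyⁱ dyʲ` in adapted charts). -/
def NormalMetric.IsFoliated {F : Foliation p q M} (g : F.NormalMetric) : Prop :=
  ∀ (V : Set M) (Y Z : ∀ x, F.Normal x), IsOpen V → F.IsFoliatedOn Y V → F.IsFoliatedOn Z V →
    F.IsBasicOn (fun x => g.toFun x (Y x) (Z x)) V

/-- The component `g_ij = g(∂/∂yⁱ, ∂/∂yʲ)` of the metric in an adapted chart. -/
def NormalMetric.comp {F : Foliation p q M} (g : F.NormalMetric)
    (e : OpenPartialHomeomorph M (FolModel p q)) (i j : Fin q) (x : M) : ℝ :=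
  g.toFun x (F.coordSection e i x) (F.coordSection e j x)

namespace NormalConnection

variable {F : Foliation p q M}

/-- A foliated connection: foliated sections are parallel along the leaves, and `D_X s` is foliated
for every infinitesimal automorphism `X` and every foliated section `s`. -/
def IsFoliated (D : F.NormalConnection) : Prop :=
  ∀ (V : Set M) (s : ∀ x, F.Normal x), IsOpen V → F.IsFoliatedOn s V →
    (∀ x ∈ V, ∀ v ∈ F.tangent x, D.toFun s x v = 0) ∧
    ∀ X : ∀ x : M, TangentSpace (folI p q) x, F.IsInfAutOn X V →
      F.IsFoliatedOn (fun x => D.toFun s x (X x)) V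

/-- Vanishing torsion: `D_X (bar Y) - D_Y (bar X) = bar [X, Y]`. -/
def IsTorsionFree (D : F.NormalConnection) : Prop :=
  ∀ (V : Set M) (X Y : ∀ x : M, TangentSpace (folI p q) x), IsOpen V →
    SmoothFieldOn X V → SmoothFieldOn Y V → ∀ x ∈ V,
      D.toFun (fun z => F.bar z (Y z)) x (X x) - D.toFun (fun z => F.bar z (X z)) x (Y x) =
        F.bar x (VectorField.mlieBracket (folI p q) X Y x)

/-- Vanishing curvature: `D_X D_Y s - D_Y D_X s - D_[X,Y] s = 0`. -/
def IsCurvatureFree (D : F.NormalConnection) : Prop :=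
  ∀ (V : Set M) (X Y : ∀ x : M, TangentSpace (folI p q) x) (s : ∀ x, F.Normal x), IsOpen V →
    SmoothFieldOn X V → SmoothFieldOn Y V → F.IsSmoothOn s V → ∀ x ∈ V,
      D.toFun (fun z => D.toFun s z (Y z)) x (X x) - D.toFun (fun z => D.toFun s z (X z)) x (Y x)
        - D.toFun s x (VectorField.mlieBracket (folI p q) X Y x) = 0

/-- A flat connection, in the sense of affine differential geometry. -/
def IsFlat (D : F.NormalConnection) : Prop := D.IsTorsionFree ∧ D.IsCurvatureFree

/-- `(D_v g)(Y, Z) = v (g(Y, Z)) - g(D_v Y, Z) - g(Y, D_v Z)` at the point `x`. -/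
def covDerivMetric (D : F.NormalConnection) (g : F.NormalMetric) (Y Z : ∀ x, F.Normal x) (x : M)
    (v : TangentSpace (folI p q) x) : ℝ :=
  funDiff (p := p) (q := q) (fun z => g.toFun z (Y z) (Z z)) x v
    - g.toFun x (D.toFun Y x v) (Z x) - g.toFun x (Y x) (D.toFun Z x v)

/-- The Levi-Civita connection of `g`: torsion-free and `g`-metric. -/
def IsLeviCivita (nabla : F.NormalConnection) (g : F.NormalMetric) : Prop :=
  nabla.IsTorsionFree ∧
    ∀ (V : Set M) (Y Z : ∀ x, F.Normal x), IsOpen V → F.IsSmoothOn Y V → F.IsSmoothOn Z V →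
      ∀ x ∈ V, ∀ v, nabla.covDerivMetric g Y Z x v = 0

/-- An affine adapted chart for `D`: the sections `∂/∂yⁱ` of the normal bundle are `D`-parallel,
i.e. the transverse coordinates are affine coordinates of `D`. -/
def IsAffineChart (D : F.NormalConnection) (e : OpenPartialHomeomorph M (FolModel p q)) : Prop :=
  F.IsAdapted e ∧ ∀ x ∈ e.source, ∀ (i : Fin q) v, D.toFun (F.coordSection e i) x v = 0

/-- `g` is a foliated Hessian metric over `W` for the flat connection `D`: around each point of `W`
there are affine transverse coordinates `y` and a basic function `h` with
`g = ∑ ∂²h/∂yⁱ∂yʲ dyⁱ dyʲ`. -/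
def HessianOn (D : F.NormalConnection) (g : F.NormalMetric) (W : Set M) : Prop :=
  ∀ x ∈ W, ∃ e, D.IsAffineChart e ∧ x ∈ e.source ∧ ∃ h : M → ℝ, F.IsBasicOn h e.source ∧
    ∀ z ∈ e.source, ∀ i j : Fin q, g.comp e i j z = partialY e (partialY e h j) i z

/-- The Codazzi equation `(D_X g)(Y, Z) = (D_Y g)(X, Z)` over `W`, for all local foliated sections
`X`, `Y`, `Z` of the normal bundle; `D_X` at a point is `D_u` for any `u` with class `X`. -/
def CodazziOn (D : F.NormalConnection) (g : F.NormalMetric) (W : Set M) : Prop :=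
  ∀ (V : Set M) (X Y Z : ∀ x, F.Normal x), IsOpen V → V ⊆ W →
    F.IsFoliatedOn X V → F.IsFoliatedOn Y V → F.IsFoliatedOn Z V →
      ∀ x ∈ V, ∀ u v, F.bar x u = X x → F.bar x v = Y x →
        D.covDerivMetric g Y Z x u = D.covDerivMetric g X Z x v

/-- The symmetry `∂g_ij/∂yᵏ = ∂g_kj/∂yⁱ` in the chart `e`. -/
def DerivSymm (g : F.NormalMetric) (e : OpenPartialHomeomorph M (FolModel p q)) : Prop :=
  ∀ x ∈ e.source, ∀ i j k : Fin q,
    partialY e (g.comp e i j) k x = partialY e (g.comp e k j) i x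

/-- The difference `γ = ∇ - D` of two connections: `γ_v s` for `v ∈ T_x M`. -/
def gam (nabla D : F.NormalConnection) (s : ∀ x, F.Normal x) (x : M)
    (v : TangentSpace (folI p q) x) : F.Normal x :=
  nabla.toFun s x v - D.toFun s x v

/-- `g(γ_X Y, Z) = g(Y, γ_X Z)` over `W`, for all local foliated sections `X`, `Y`, `Z` of the
normal bundle; `γ_X` at a point is `γ_u` for any `u` with class `X`. -/
def GamSelfAdjointOn (nabla D : F.NormalConnection) (g : F.NormalMetric) (W : Set M) : Prop :=
  ∀ (V : Set M) (X Y Z : ∀ x, F.Normal x), IsOpen V → V ⊆ W →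
    F.IsFoliatedOn X V → F.IsFoliatedOn Y V → F.IsFoliatedOn Z V →
      ∀ x ∈ V, ∀ u, F.bar x u = X x →
        g.toFun x (gam nabla D Y x u) (Z x) = g.toFun x (Y x) (gam nabla D Z x u)

/-- The components `γˢ_jk` of `γ` in an adapted chart:
`γ_{∂/∂yʲ} ∂/∂yᵏ = ∑_s γˢ_jk ∂/∂yˢ`. -/
def gamUpper (nabla D : F.NormalConnection) (e : OpenPartialHomeomorph M (FolModel p q))
    (s j k : Fin q) (x : M) : ℝ :=
  F.coeff e x (gam nabla D (F.coordSection e k) x (coordVec e j x)) s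

/-- The components `γ_ijk = ∑_s g_is γˢ_jk`. -/
def gamLower (nabla D : F.NormalConnection) (g : F.NormalMetric)
    (e : OpenPartialHomeomorph M (FolModel p q)) (i j k : Fin q) (x : M) : ℝ :=
  ∑ s : Fin q, g.comp e i s x * gamUpper nabla D e s j k x

/-- The symmetry `γ_ijk = γ_jik` in the chart `e`. -/
def GamLowerSymm (nabla D : F.NormalConnection) (g : F.NormalMetric)
    (e : OpenPartialHomeomorph M (FolModel p q)) : Prop :=
  ∀ x ∈ e.source, ∀ i j k : Fin q,
    gamLower nabla D g e i j k x = gamLower nabla D g e j i k x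

end NormalConnection

end Foliation

end

/-! Everything reduces to one pointwise symmetry. Since `D` and `∇` are both torsion-free, their
difference `γ` is a symmetric bilinear map `B` on each fibre of the normal bundle
(`exists_gam_tensor`). Each of the five conditions is equivalent to `g(a, γ_b c) = g(b, γ_a c)` at
the relevant points, which is `CodazziAt`.

Subtracting `∇g = 0` gives `(D_v g)(Y, Z) = g(γ_v Y, Z) + g(Y, γ_v Z)`. On exchanging `v` and `Y`
the first term is unchanged, so the Codazzi equation is the symmetry of the second. Self-adjointness
of `γ` is the same identity after `γ_c b = γ_b c`, and the symmetry of `γ_ijk` is the identity on a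
basis. In an affine chart `∂_k g_ij = (D_{∂_k} g)(∂_i, ∂_j)`, so the symmetry of the derivatives is
the Codazzi equation on a basis.

A Hessian metric satisfies the symmetry because third derivatives of `h` commute. Conversely, in an
affine chart with a ball as range, foliatedness makes the `g_ij` functions of `y` alone. The Codazzi
symmetry says that each one-form `∑ g_ij dyⁱ` is closed, so the Poincaré lemma gives primitives
`θ_j`. The symmetry of `g` makes `∑ θ_j dyʲ` closed, and a second primitive is the potential
(`exists_potential`).

The remaining ingredient is the existence of affine charts (`exists_isAffineChart`). The Christoffel
symbols `G` of a foliated connection depend only on `y`. Vanishing curvature is the integrability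
condition of `dP = P ∘ G`, solved by Picard iteration along rays. Vanishing torsion makes `P`
closed, and a primitive of `P` with `P(y₀) = id` is a local diffeomorphism giving the affine
coordinates. -/

noncomputable section

set_option maxSynthPendingDepth 3
set_option linter.unusedSectionVars false
set_option linter.unusedVariables false

/-! ### Total differential equations: Picard iteration along rays -/

section TotalDifferentialEquation

open MeasureTheory Filter

variable {E F : Type*} [NormedAddCommGroup E] [NormedSpace ℝ E] [FiniteDimensional ℝ E]
  [NormedAddCommGroup F] [NormedSpace ℝ F] [FiniteDimensional ℝ F]

/-- Differentiation under the integral sign over `[0, 1]` with a jointly `C¹` integrand. -/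
theorem hasFDerivAt_integral_unitInterval {G : E × ℝ → F} (hG : ContDiff ℝ 1 G) (y : E) :
    HasFDerivAt (fun y => ∫ t in (0 : ℝ)..1, G (y, t))
      (∫ t in (0 : ℝ)..1, fderiv ℝ (fun y => G (y, t)) y) y := by
  have hd : ∀ y t, HasFDerivAt (fun y => G (y, t))
      ((fderiv ℝ G (y, t)).comp (ContinuousLinearMap.inl ℝ E ℝ)) y := fun y t =>
    ((hG.differentiable one_ne_zero (y, t)).hasFDerivAt).comp y (hasFDerivAt_prodMk_left y t)
  have hcont : Continuous fun z : E × ℝ =>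
      (fderiv ℝ G z).comp (ContinuousLinearMap.inl ℝ E ℝ) :=
    (hG.continuous_fderiv one_ne_zero).clm_comp continuous_const
  -- In finite dimension closed balls are compact, so the partial derivative is bounded on a unit
  -- ball times `[0, 1]`; this constant is the dominating function.
  have hK : IsCompact (Metric.closedBall y 1 ×ˢ Set.Icc (0 : ℝ) 1) :=
    (isCompact_closedBall y 1).prod isCompact_Icc
  obtain ⟨C, hC⟩ := hK.exists_bound_of_continuousOn hcont.continuousOn
  have h := intervalIntegral.hasFDerivAt_integral_of_dominated_of_fderiv_le
    (μ := volume) (a := 0) (b := 1) (F := fun y t => G (y, t))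
    (F' := fun y t => (fderiv ℝ G (y, t)).comp (ContinuousLinearMap.inl ℝ E ℝ))
    (bound := fun _ => C) (x₀ := y) (Metric.closedBall_mem_nhds y one_pos)
    (Eventually.of_forall fun x =>
      (hG.continuous.comp (by fun_prop : Continuous fun t : ℝ => (x, t))).aestronglyMeasurable)
    ((hG.continuous.comp (by fun_prop : Continuous fun t : ℝ => (y, t))).intervalIntegrable _ _)
    (hcont.comp (by fun_prop : Continuous fun t : ℝ => (y, t))).aestronglyMeasurable
    (Eventually.of_forall fun t ht x hx => hC (x, t) ⟨hx, by
      rw [Set.uIoc_of_le zero_le_one] at ht; exact ⟨ht.1.le, ht.2⟩⟩)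
    (by simp) (Eventually.of_forall fun t _ x _ => hd x t)
  simpa only [(hd y _).fderiv] using h

theorem contDiff_one_integral_unitInterval {G : E × ℝ → F} (hG : ContDiff ℝ 1 G) :
    ContDiff ℝ 1 (fun y => ∫ t in (0 : ℝ)..1, G (y, t)) := by
  rw [contDiff_one_iff_hasFDerivAt]
  refine ⟨_, ?_, fun y => hasFDerivAt_integral_unitInterval hG y⟩
  have hd : ∀ y t, fderiv ℝ (fun y => G (y, t)) y =
      (fderiv ℝ G (y, t)).comp (ContinuousLinearMap.inl ℝ E ℝ) := fun y t =>
    (((hG.differentiable one_ne_zero (y, t)).hasFDerivAt).comp y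
      (hasFDerivAt_prodMk_left y t)).fderiv
  simp only [hd]
  refine intervalIntegral.continuous_parametric_intervalIntegral_of_continuous' (f := fun y t =>
    (fderiv ℝ G (y, t)).comp (ContinuousLinearMap.inl ℝ E ℝ)) ?_ 0 1
  exact (hG.continuous_fderiv one_ne_zero).clm_comp continuous_const

/-- The Picard operator, along rays from the origin, of the total differential equation
`du = A u`. -/
def radialPicard (A : E → E →L[ℝ] F →L[ℝ] F) (c : F) (u : E → F) (y : E) : F :=
  c + ∫ t in (0 : ℝ)..1, A (t • y) y (u (t • y))

theorem contDiff_radialPicard_integrand {A : E → E →L[ℝ] F →L[ℝ] F} (hA : ContDiff ℝ 1 A)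
    {u : E → F} (hu : ContDiff ℝ 1 u) :
    ContDiff ℝ 1 (fun z : E × ℝ => A (z.2 • z.1) z.1 (u (z.2 • z.1))) := by
  have h : ContDiff ℝ 1 (fun z : E × ℝ => z.2 • z.1) := contDiff_snd.smul contDiff_fst
  exact ((hA.comp h).clm_apply contDiff_fst).clm_apply (hu.comp h)

theorem contDiff_radialPicard {A : E → E →L[ℝ] F →L[ℝ] F} (hA : ContDiff ℝ 1 A) (c : F)
    {u : E → F} (hu : ContDiff ℝ 1 u) : ContDiff ℝ 1 (radialPicard A c u) :=
  contDiff_const.add (contDiff_one_integral_unitInterval (contDiff_radialPicard_integrand hA hu))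

theorem hasFDerivAt_comp_smul {G : Type*} [NormedAddCommGroup G] [NormedSpace ℝ G] {f : E → G}
    (hf : Differentiable ℝ f) (t : ℝ) (y : E) :
    HasFDerivAt (fun y => f (t • y)) (t • fderiv ℝ f (t • y)) y := by
  refine ((hf (t • y)).hasFDerivAt.comp y ((hasFDerivAt_id y).const_smul t)).congr_fderiv ?_
  ext v; simp

theorem hasDerivAt_comp_smul {G : Type*} [NormedAddCommGroup G] [NormedSpace ℝ G] {f : E → G}
    (hf : Differentiable ℝ f) (t : ℝ) (y : E) :
    HasDerivAt (fun t : ℝ => f (t • y)) (fderiv ℝ f (t • y) y) t := by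
  refine (hf (t • y)).hasFDerivAt.comp_hasDerivAt t ?_
  simpa using (hasDerivAt_id t).smul_const y

/-- The failure of `u` to solve `du = A u`. -/
def totalDefect (A : E → E →L[ℝ] F →L[ℝ] F) (u : E → F) (x : E) : E →L[ℝ] F :=
  fderiv ℝ u x - (A x).flip (u x)

theorem continuous_totalDefect {A : E → E →L[ℝ] F →L[ℝ] F} (hA : ContDiff ℝ 1 A)
    {u : E → F} (hu : ContDiff ℝ 1 u) : Continuous (totalDefect A u) := by
  refine (hu.continuous_fderiv one_ne_zero).sub ?_
  exact (((ContinuousLinearMap.flipₗᵢ ℝ E F F).continuous.comp hA.continuous)).clm_apply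
    hu.continuous

/-- The integrability condition exchanges `h` and `y` in the derivative of `A`. The `h`-derivative
of the integrand thus becomes the `t`-derivative of `t • A (t • y) h (u (t • y))` plus terms that
involve `u` only through its defect. Integrating the exact part leaves the boundary value `A y h (u
y)`, so the defect of the next iterate is controlled by that of the present one. -/
theorem fderiv_radialPicard {A : E → E →L[ℝ] F →L[ℝ] F} (hA : ContDiff ℝ 1 A) (c : F)
    {u : E → F} (hu : ContDiff ℝ 1 u) (y h : E)
    (hflat : ∀ t ∈ Set.Icc (0 : ℝ) 1, ∀ v w f,
      fderiv ℝ A (t • y) v w f + A (t • y) w (A (t • y) v f) =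
        fderiv ℝ A (t • y) w v f + A (t • y) v (A (t • y) w f)) :
    fderiv ℝ (radialPicard A c u) y h = A y h (u y) +
      ∫ t in (0 : ℝ)..1, t • (A (t • y) y (totalDefect A u (t • y) h)
        - A (t • y) h (totalDefect A u (t • y) y)) := by
  have hG := contDiff_radialPicard_integrand hA hu
  have h1 : fderiv ℝ (radialPicard A c u) y =
      ∫ t in (0 : ℝ)..1, fderiv ℝ (fun y => A (t • y) y (u (t • y))) y :=
    ((hasFDerivAt_integral_unitInterval hG y).const_add c).fderiv
  have hFd : ∀ t : ℝ, fderiv ℝ (fun y => A (t • y) y (u (t • y))) y h =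
      t • fderiv ℝ A (t • y) h y (u (t • y)) + A (t • y) h (u (t • y))
        + t • A (t • y) y (fderiv ℝ u (t • y) h) := by
    intro t
    have a1 := hasFDerivAt_comp_smul (hA.differentiable one_ne_zero) t y
    have a2 := hasFDerivAt_comp_smul (hu.differentiable one_ne_zero) t y
    have a3 : HasFDerivAt (fun y : E => A (t • y) y) _ y := a1.clm_apply (hasFDerivAt_id y)
    rw [(a3.clm_apply a2).fderiv]
    simp
    abel
  have hcont : Continuous fun t : ℝ => fderiv ℝ (fun y => A (t • y) y (u (t • y))) y h := by
    simp only [hFd]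
    have hs : Continuous fun t : ℝ => t • y := by fun_prop
    have c1 := hu.continuous.comp hs
    have c2 := (hu.continuous_fderiv one_ne_zero).comp hs
    have c3 := hA.continuous.comp hs
    have c4 := (hA.continuous_fderiv one_ne_zero).comp hs
    exact ((continuous_id.smul (((c4.clm_apply continuous_const).clm_apply
      continuous_const).clm_apply c1)).add ((c3.clm_apply continuous_const).clm_apply c1)).add
      (continuous_id.smul ((c3.clm_apply continuous_const).clm_apply
        (c2.clm_apply continuous_const)))
  have hz : Continuous fun t : ℝ => t • (A (t • y) y (totalDefect A u (t • y) h)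
        - A (t • y) h (totalDefect A u (t • y) y)) := by
    have hs : Continuous fun t : ℝ => t • y := by fun_prop
    have c1 := (continuous_totalDefect hA hu).comp hs
    have c3 := hA.continuous.comp hs
    exact continuous_id.smul (((c3.clm_apply continuous_const).clm_apply
      (c1.clm_apply continuous_const)).sub ((c3.clm_apply continuous_const).clm_apply
      (c1.clm_apply continuous_const)))
  have hder : ∀ t ∈ Set.uIcc (0 : ℝ) 1, HasDerivAt (fun t : ℝ => t • A (t • y) h (u (t • y)))
      (fderiv ℝ (fun y => A (t • y) y (u (t • y))) y h
        - t • (A (t • y) y (totalDefect A u (t • y) h)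
        - A (t • y) h (totalDefect A u (t • y) y))) t := by
    intro t ht
    rw [Set.uIcc_of_le zero_le_one] at ht
    have b1 := hasDerivAt_comp_smul (hA.differentiable one_ne_zero) t y
    have b2 := hasDerivAt_comp_smul (hu.differentiable one_ne_zero) t y
    have b3 : HasDerivAt (fun t : ℝ => A (t • y) h) (fderiv ℝ A (t • y) y h) t := by
      simpa using b1.clm_apply (hasDerivAt_const t h)
    have b4 : HasDerivAt (fun t : ℝ => A (t • y) h (u (t • y))) _ t := b3.clm_apply b2
    refine ((hasDerivAt_id t).smul b4).congr_deriv ?_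
    rw [hFd]
    have hf := hflat t ht h y (u (t • y))
    have hf' : fderiv ℝ A (t • y) h y (u (t • y)) = fderiv ℝ A (t • y) y h (u (t • y))
        + A (t • y) h (A (t • y) y (u (t • y))) - A (t • y) y (A (t • y) h (u (t • y))) :=
      eq_sub_of_add_eq hf
    rw [hf']
    simp [totalDefect, smul_sub, smul_add]
    abel
  have h4 := intervalIntegral.integral_eq_sub_of_hasDerivAt hder
    ((hcont.sub hz).intervalIntegrable _ _)
  rw [intervalIntegral.integral_sub (hcont.intervalIntegrable _ _) (hz.intervalIntegrable _ _)]
    at h4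
  have hint : IntervalIntegrable (fun t : ℝ => fderiv ℝ (fun y => A (t • y) y (u (t • y))) y)
      volume 0 1 := by
    refine Continuous.intervalIntegrable ?_ _ _
    have hd : ∀ t : ℝ, fderiv ℝ (fun y => A (t • y) y (u (t • y))) y = (fderiv ℝ
        (fun z : E × ℝ => A (z.2 • z.1) z.1 (u (z.2 • z.1))) (y, t)).comp
          (ContinuousLinearMap.inl ℝ E ℝ) := fun t =>
      HasFDerivAt.fderiv (((hG.differentiable one_ne_zero (y, t)).hasFDerivAt).comp
        (f := fun y => (y, t)) y (hasFDerivAt_prodMk_left y t))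
    simp only [hd]
    exact ((hG.continuous_fderiv one_ne_zero).comp (by fun_prop)).clm_comp continuous_const
  rw [h1, ContinuousLinearMap.intervalIntegral_apply hint]
  simp only [one_smul, zero_smul, sub_zero] at h4
  rw [← h4]
  abel

/-- A total differential equation `du = A u` satisfying the integrability condition near the
origin has local solutions with arbitrary initial value. -/
theorem exists_hasFDerivAt_of_integrable_zero {A : E → E →L[ℝ] F →L[ℝ] F} (hA : ContDiff ℝ 1 A)
    {ρ : ℝ} (hρ : 0 < ρ) (hflat : ∀ x ∈ Metric.ball (0 : E) ρ, ∀ v w f,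
      fderiv ℝ A x v w f + A x w (A x v f) = fderiv ℝ A x w v f + A x v (A x w f)) (c : F) :
    ∃ r > 0, ∃ u : E → F, u 0 = c ∧
      ∀ y ∈ Metric.ball (0 : E) r, HasFDerivAt u ((A y).flip (u y)) y := by
  obtain ⟨C₀, hC₀⟩ := (isCompact_closedBall (0 : E) ρ).exists_bound_of_continuousOn
    (f := A) hA.continuous.continuousOn
  set C := max C₀ 1 with hCdef
  have hC1 : 1 ≤ C := le_max_right _ _
  have hC0 : 0 < C := by linarith
  -- The radius is chosen so that `C * r ≤ 1 / 8`: the Picard operator then contracts, and each of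
  -- the two terms in the defect integral below has factor `1 / 8`.
  set r := min ρ (1 / (8 * C)) with hr
  have hr0 : 0 < r := lt_min hρ (by positivity)
  have hCr : C * r ≤ 1 / 8 := by
    calc C * r ≤ C * (1 / (8 * C)) := by gcongr; exact min_le_right _ _
      _ = 1 / 8 := by field_simp
  have hCA : ∀ y ∈ Metric.ball (0 : E) r, ‖A y‖ ≤ C := fun y hy =>
    (hC₀ y (Metric.closedBall_subset_closedBall (min_le_left _ _)
      (Metric.ball_subset_closedBall hy))).trans (le_max_left _ _)
  have hseg : ∀ y ∈ Metric.ball (0 : E) r, ∀ t ∈ Set.Icc (0 : ℝ) 1,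
      t • y ∈ Metric.ball (0 : E) r := by
    intro y hy t ht
    rw [mem_ball_zero_iff] at hy ⊢
    rw [norm_smul, Real.norm_of_nonneg ht.1]
    nlinarith [norm_nonneg y, ht.2]
  have hAyy : ∀ y ∈ Metric.ball (0 : E) r, ∀ t ∈ Set.Icc (0 : ℝ) 1, ∀ f,
      ‖A (t • y) y f‖ ≤ 1 / 8 * ‖f‖ := by
    intro y hy t ht f
    have hy' := (mem_ball_zero_iff.1 hy).le
    calc ‖A (t • y) y f‖ ≤ ‖A (t • y)‖ * ‖y‖ * ‖f‖ := (A (t • y)).le_opNorm₂ y f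
      _ ≤ C * r * ‖f‖ := by gcongr; exact hCA _ (hseg y hy t ht)
      _ ≤ 1 / 8 * ‖f‖ := by gcongr
  let u : ℕ → E → F := fun n => (radialPicard A c)^[n] (fun _ => c)
  have hu0 : u 0 = fun _ => c := rfl
  have hus : ∀ n, u (n + 1) = radialPicard A c (u n) := fun n =>
    Function.iterate_succ_apply' _ _ _
  have huC : ∀ n, ContDiff ℝ 1 (u n) := by
    intro n
    induction n with
    | zero => exact contDiff_const
    | succ n ih => rw [hus]; exact contDiff_radialPicard hA c ih
  have hdiff : ∀ n, ∀ y ∈ Metric.ball (0 : E) r, ‖u n y - u (n + 1) y‖ ≤ ‖c‖ * (1 / 2) ^ n := by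
    intro n
    induction n with
    | zero =>
      intro y hy
      rw [hus, hu0, radialPicard]
      simp only [sub_add_cancel_left, norm_neg, pow_zero, mul_one]
      have := intervalIntegral.norm_integral_le_of_norm_le_const (a := 0) (b := 1)
        (f := fun t : ℝ => A (t • y) y c) (C := 1 / 8 * ‖c‖) (fun t ht => by
          rw [Set.uIoc_of_le zero_le_one] at ht
          exact hAyy y hy t ⟨ht.1.le, ht.2⟩ c)
      rw [sub_zero, abs_one, mul_one] at this
      linarith [norm_nonneg c]
    | succ n ih =>
      intro y hy
      have hint : ∀ m, IntervalIntegrable (fun t : ℝ => A (t • y) y (u m (t • y))) volume 0 1 :=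
        fun m => ((contDiff_radialPicard_integrand hA (huC m)).continuous.comp
          (by fun_prop : Continuous fun t : ℝ => (y, t))).intervalIntegrable _ _
      rw [hus (n + 1), hus n, radialPicard, radialPicard, ← hus n, add_sub_add_left_eq_sub,
        ← intervalIntegral.integral_sub (hint _) (hint _)]
      have := intervalIntegral.norm_integral_le_of_norm_le_const (a := 0) (b := 1)
        (f := fun t : ℝ => A (t • y) y (u n (t • y)) - A (t • y) y (u (n + 1) (t • y)))
        (C := 1 / 8 * (‖c‖ * (1 / 2) ^ n)) (fun t ht => by
          rw [Set.uIoc_of_le zero_le_one] at ht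
          rw [← map_sub]
          refine (hAyy y hy t ⟨ht.1.le, ht.2⟩ _).trans ?_
          gcongr
          exact ih _ (hseg y hy t ⟨ht.1.le, ht.2⟩))
      rw [sub_zero, abs_one, mul_one] at this
      refine this.trans ?_
      rw [pow_succ]
      have : 0 ≤ ‖c‖ * (1 / 2) ^ n := by positivity
      linarith
  have hflip : ∀ y ∈ Metric.ball (0 : E) r, ∀ f, ‖(A y).flip f‖ ≤ C * ‖f‖ := by
    intro y hy f
    refine ((A y).flip.le_opNorm f).trans ?_
    rw [ContinuousLinearMap.opNorm_flip]
    gcongr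
    exact hCA y hy
  -- The defects decay geometrically too. With `N` the bound at stage `n`, the difference of
  -- consecutive iterates contributes `C * ‖c‖ * (1 / 2) ^ n = N / 4`, which fixes the constant 4,
  -- and the integral contributes `N / 8 + N / 8`; the total is `N / 2`.
  have hdef : ∀ n, ∀ y ∈ Metric.ball (0 : E) r,
      ‖totalDefect A (u n) y‖ ≤ 4 * C * ‖c‖ * (1 / 2) ^ n := by
    intro n
    induction n with
    | zero =>
      intro y hy
      have : totalDefect A (u 0) y = -(A y).flip c := by
        rw [totalDefect, hu0]; simp
      rw [this, norm_neg, pow_zero, mul_one]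
      refine (hflip y hy c).trans ?_
      nlinarith [norm_nonneg c, mul_nonneg hC0.le (norm_nonneg c)]
    | succ n ih =>
      intro y hy
      refine ContinuousLinearMap.opNorm_le_bound _ (by positivity) fun h => ?_
      have hfl : ∀ t ∈ Set.Icc (0 : ℝ) 1, ∀ v w f,
          fderiv ℝ A (t • y) v w f + A (t • y) w (A (t • y) v f) =
            fderiv ℝ A (t • y) w v f + A (t • y) v (A (t • y) w f) := fun t ht =>
        hflat _ (Metric.ball_subset_ball (min_le_left _ _) (hseg y hy t ht))
      have key : totalDefect A (u (n + 1)) y h = (A y).flip (u n y - u (n + 1) y) h +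
          ∫ t in (0 : ℝ)..1, t • (A (t • y) y (totalDefect A (u n) (t • y) h)
            - A (t • y) h (totalDefect A (u n) (t • y) y)) := by
        rw [totalDefect, sub_apply]
        nth_rewrite 1 [hus]
        rw [fderiv_radialPicard hA c (huC n) y h hfl]
        simp only [ContinuousLinearMap.flip_apply, map_sub, sub_apply]
        abel
      set N := 4 * C * ‖c‖ * (1 / 2) ^ n with hN
      have hN0 : 0 ≤ N := by positivity
      have b1 : ‖(A y).flip (u n y - u (n + 1) y) h‖ ≤ N / 4 * ‖h‖ := by
        refine ((ContinuousLinearMap.le_opNorm _ _)).trans ?_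
        gcongr
        refine (hflip y hy _).trans ((mul_le_mul_of_nonneg_left (hdiff n y hy) hC0.le).trans ?_)
        rw [hN]; apply le_of_eq; ring
      have b2 : ‖∫ t in (0 : ℝ)..1, t • (A (t • y) y (totalDefect A (u n) (t • y) h)
            - A (t • y) h (totalDefect A (u n) (t • y) y))‖ ≤ N / 4 * ‖h‖ := by
        have := intervalIntegral.norm_integral_le_of_norm_le_const (a := 0) (b := 1)
          (f := fun t : ℝ => t • (A (t • y) y (totalDefect A (u n) (t • y) h)
            - A (t • y) h (totalDefect A (u n) (t • y) y))) (C := N / 4 * ‖h‖) (fun t ht => by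
          rw [Set.uIoc_of_le zero_le_one] at ht
          have ht' : t ∈ Set.Icc (0 : ℝ) 1 := ⟨ht.1.le, ht.2⟩
          have hzt := ih _ (hseg y hy t ht')
          have hz : ∀ v, ‖totalDefect A (u n) (t • y) v‖ ≤ N * ‖v‖ := fun v =>
            (ContinuousLinearMap.le_opNorm _ _).trans (by gcongr)
          have e1 : ‖A (t • y) y (totalDefect A (u n) (t • y) h)‖ ≤ 1 / 8 * (N * ‖h‖) :=
            (hAyy y hy t ht' _).trans (by gcongr; exact hz h)
          have e2 : ‖A (t • y) h (totalDefect A (u n) (t • y) y)‖ ≤ 1 / 8 * (N * ‖h‖) := by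
            calc _ ≤ ‖A (t • y)‖ * ‖h‖ * ‖totalDefect A (u n) (t • y) y‖ :=
                  (A (t • y)).le_opNorm₂ _ _
              _ ≤ C * ‖h‖ * (N * r) := by
                  gcongr
                  · exact hCA _ (hseg y hy t ht')
                  · refine (hz y).trans ?_
                    gcongr
                    exact (mem_ball_zero_iff.1 hy).le
              _ = C * r * (N * ‖h‖) := by ring
              _ ≤ _ := by gcongr
          rw [norm_smul, Real.norm_of_nonneg ht.1.le]
          have e3 := norm_sub_le (A (t • y) y (totalDefect A (u n) (t • y) h))
            (A (t • y) h (totalDefect A (u n) (t • y) y))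
          have e4 : 0 ≤ N * ‖h‖ := by positivity
          calc _ ≤ 1 * _ := mul_le_mul_of_nonneg_right ht.2 (norm_nonneg _)
            _ ≤ _ := by linarith)
        rw [sub_zero, abs_one, mul_one] at this
        exact this
      rw [key]
      refine (norm_add_le _ _).trans ((add_le_add b1 b2).trans (le_of_eq ?_))
      rw [pow_succ, hN]; ring
  have hcau : ∀ y ∈ Metric.ball (0 : E) r, ∀ n, dist (u n y) (u (n + 1) y) ≤ ‖c‖ * (1 / 2) ^ n :=
    fun y hy n => by rw [dist_eq_norm]; exact hdiff n y hy
  have hlim : ∀ y, ∃ a, y ∈ Metric.ball (0 : E) r → Tendsto (fun n => u n y) atTop (𝓝 a) := by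
    intro y
    by_cases hy : y ∈ Metric.ball (0 : E) r
    · obtain ⟨a, ha⟩ := cauchySeq_tendsto_of_complete
        (cauchySeq_of_le_geometric (1 / 2) ‖c‖ (by norm_num) (hcau y hy))
      exact ⟨a, fun _ => ha⟩
    · exact ⟨0, fun h => absurd h hy⟩
  choose U hU using hlim
  refine ⟨r, hr0, U, ?_, fun y hy => ?_⟩
  · refine tendsto_nhds_unique (hU 0 (Metric.mem_ball_self hr0)) ?_
    refine tendsto_const_nhds.congr fun n => ?_
    cases n with
    | zero => rfl
    | succ n => rw [hus]; simp [radialPicard]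
  · refine hasFDerivAt_of_tendstoUniformlyOn (f := u) (f' := fun n => fderiv ℝ (u n))
      (g' := fun y => (A y).flip (U y)) Metric.isOpen_ball (l := atTop) ?_
      (fun n x _ => ((huC n).differentiable one_ne_zero x).hasFDerivAt) (fun x hx => hU x hx) hy
    -- The derivative of `u n` differs from `(A x).flip (U x)` by the defect, at most `4 * C * ‖c‖ *
    -- (1 / 2) ^ n`, and by `A` applied to `u n - U`, at most `2 * C * ‖c‖ * (1 / 2) ^ n` by the
    -- geometric tail. Hence the constant 6.
    rw [Metric.tendstoUniformlyOn_iff]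
    intro ε hε
    have htend : Tendsto (fun n : ℕ => (6 * C * ‖c‖) * (1 / 2 : ℝ) ^ n) atTop (𝓝 0) := by
      simpa using (tendsto_pow_atTop_nhds_zero_of_lt_one (by norm_num : (0 : ℝ) ≤ 1 / 2)
        (by norm_num)).const_mul (6 * C * ‖c‖)
    filter_upwards [htend.eventually_lt_const hε] with n hn x hx
    refine lt_of_le_of_lt ?_ hn
    have e1 : ‖u n x - U x‖ ≤ ‖c‖ * (1 / 2) ^ n / (1 - 1 / 2) := by
      rw [← dist_eq_norm]
      exact dist_le_of_le_geometric_of_tendsto _ _ (by norm_num) (hcau x hx) (hU x hx) n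
    have e2 : fderiv ℝ (u n) x - (A x).flip (U x) =
        totalDefect A (u n) x + (A x).flip (u n x - U x) := by
      rw [totalDefect, map_sub]; abel
    rw [dist_comm, dist_eq_norm, e2]
    refine (norm_add_le _ _).trans ((add_le_add (hdef n x hx)
      ((hflip x hx _).trans (mul_le_mul_of_nonneg_left e1 hC0.le))).trans (le_of_eq ?_))
    ring

end TotalDifferentialEquation

/-! ### Smooth solutions and affine coordinates on a vector space -/

section TotalDifferentialEquation

variable {E F : Type*} [NormedAddCommGroup E] [NormedSpace ℝ E] [FiniteDimensional ℝ E]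
  [NormedAddCommGroup F] [NormedSpace ℝ F]

/-- A function that is smooth on an open set agrees near each point of it with a function that is
smooth everywhere. -/
theorem exists_contDiff_eqOn_ball {B : Set E} (hB : IsOpen B) {f : E → F}
    (hf : ContDiffOn ℝ ∞ f B) {y₀ : E} (hy₀ : y₀ ∈ B) :
    ∃ f' : E → F, ContDiff ℝ ∞ f' ∧ ∃ r > 0, Metric.ball y₀ r ⊆ B ∧
      Set.EqOn f' f (Metric.ball y₀ r) := by
  obtain ⟨ε, hε, hεB⟩ := Metric.isOpen_iff.1 hB y₀ hy₀
  -- The bump is 1 on the ball of radius `ε / 4` and its support lies in the closed ball of radius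
  -- `ε / 2`, well inside `B`, so extending `χ • f` by zero is smooth.
  let χ : ContDiffBump y₀ := ⟨ε / 4, ε / 2, by positivity, by linarith⟩
  refine ⟨fun x => χ x • f x, ?_, ε / 4, by positivity,
    (Metric.ball_subset_ball (by linarith)).trans hεB, fun x hx => ?_⟩
  · refine contMDiff_iff_contDiff.1 (contMDiff_of_tsupport fun x hx => ?_)
    have hx' : x ∈ Metric.closedBall y₀ (ε / 2) := by
      rw [← χ.tsupport_eq]
      exact closure_mono (Function.support_smul_subset_left _ _) hx
    have hxB : x ∈ B := hεB (Metric.closedBall_subset_ball (by linarith) hx')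
    exact (χ.contDiffAt.smul (hf.contDiffAt (hB.mem_nhds hxB))).contMDiffAt
  · have : χ x = 1 := χ.one_of_mem_closedBall (Metric.ball_subset_closedBall hx)
    simp [this]

/-- Primitives produced by the Poincaré lemma are only known to be differentiable; this makes the
affine coordinates and the Hessian potential smooth. -/
theorem contDiffOn_infty_of_hasFDerivAt {B : Set E} (hB : IsOpen B) {f : E → F}
    {f' : E → E →L[ℝ] F} (hf : ∀ y ∈ B, HasFDerivAt f (f' y) y) (hf' : ContDiffOn ℝ ∞ f' B) :
    ContDiffOn ℝ ∞ f B := by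
  refine contDiffOn_infty.2 fun n => ContDiffOn.of_le (n := (n : ℕ∞ω) + 1) ?_ (by simp)
  rw [contDiffOn_succ_iff_fderiv_of_isOpen hB]
  exact ⟨fun y hy => (hf y hy).differentiableAt.differentiableWithinAt, by simp,
    (hf'.of_le (by exact_mod_cast le_top)).congr fun y hy => (hf y hy).fderiv⟩

/-- Solutions of `du = A u` are as smooth as `A`. -/
theorem contDiffOn_of_hasFDerivAt_flip {B : Set E} (hB : IsOpen B)
    {A : E → E →L[ℝ] F →L[ℝ] F} (hA : ContDiffOn ℝ ∞ A B) {u : E → F}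
    (hu : ∀ y ∈ B, HasFDerivAt u ((A y).flip (u y)) y) : ContDiffOn ℝ ∞ u B := by
  have hd : DifferentiableOn ℝ u B := fun y hy => (hu y hy).differentiableAt.differentiableWithinAt
  have key : ∀ n : ℕ, ContDiffOn ℝ n u B := by
    intro n
    -- Bootstrapping: if `u` is `Cⁿ`, then its derivative `(A y).flip (u y)` is `Cⁿ`, so `u` is
    -- `Cⁿ⁺¹`.
    induction n with
    | zero => exact contDiffOn_zero.2 hd.continuousOn
    | succ n ih =>
      rw [Nat.cast_succ, contDiffOn_succ_iff_fderiv_of_isOpen hB]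
      refine ⟨hd, by simp, ?_⟩
      have h1 : ContDiffOn ℝ n (fun y => (A y).flip (u y)) B :=
        ContDiffOn.clm_apply (f := fun y => (A y).flip)
          ((ContinuousLinearMap.flipₗᵢ ℝ E F F).contDiff.comp_contDiffOn (f := A)
            (hA.of_le (by exact_mod_cast le_top))) ih
      exact h1.congr fun y hy => (hu y hy).fderiv
  exact contDiffOn_infty.2 key

/-- Local solvability of the total differential equation `du = A u` under the integrability
condition. -/
theorem exists_hasFDerivAt_of_integrable [FiniteDimensional ℝ F] {B : Set E} (hB : IsOpen B)
    {A : E → E →L[ℝ] F →L[ℝ] F} (hA : ContDiffOn ℝ ∞ A B) {y₀ : E} (hy₀ : y₀ ∈ B)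
    (hflat : ∀ x ∈ B, ∀ v w f,
      fderiv ℝ A x v w f + A x w (A x v f) = fderiv ℝ A x w v f + A x v (A x w f)) (c : F) :
    ∃ r > 0, Metric.ball y₀ r ⊆ B ∧ ∃ u : E → F, u y₀ = c ∧
      ContDiffOn ℝ ∞ u (Metric.ball y₀ r) ∧
      ∀ y ∈ Metric.ball y₀ r, HasFDerivAt u ((A y).flip (u y)) y := by
  -- The Picard operator requires coefficients that are `C¹` on the whole space, so `A` is cut off;
  -- the integrability condition survives on the ball where nothing has changed.
  obtain ⟨A', hA', ρ, hρ, hρB, hAA'⟩ := exists_contDiff_eqOn_ball hB hA hy₀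
  have hmem : ∀ {s : ℝ} {x : E}, x ∈ Metric.ball (0 : E) s ↔ y₀ + x ∈ Metric.ball y₀ s := by
    intro s x; simp
  obtain ⟨r, hr, u, hu0, hu⟩ := exists_hasFDerivAt_of_integrable_zero
    (A := fun x => A' (y₀ + x)) ((hA'.comp (contDiff_const.add contDiff_id)).of_le (by simp)) hρ
    (fun x hx v w f => by
      have hx' := hmem.1 hx
      have e1 : fderiv ℝ (fun x => A' (y₀ + x)) x = fderiv ℝ A (y₀ + x) := by
        have h1 : HasFDerivAt A' (fderiv ℝ A' (y₀ + x)) (y₀ + x) :=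
          (hA'.differentiable (by simp) _).hasFDerivAt
        rw [((hasFDerivAt_comp_add_left y₀).2 h1).fderiv]
        exact (Filter.eventuallyEq_of_mem (Metric.isOpen_ball.mem_nhds hx') hAA').fderiv_eq
      rw [e1, hAA' hx']
      exact hflat _ (hρB hx') v w f) c
  have hsub : Metric.ball y₀ (min r ρ) ⊆ B :=
    (Metric.ball_subset_ball (min_le_right _ _)).trans hρB
  have hder : ∀ y ∈ Metric.ball y₀ (min r ρ),
      HasFDerivAt (fun y => u (y - y₀)) ((A y).flip (u (y - y₀))) y := by
    intro y hy
    have h1 := hu (y - y₀) (Metric.ball_subset_ball (min_le_left r ρ) (hmem.2 (by simpa using hy)))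
    rw [add_sub_cancel, hAA' (Metric.ball_subset_ball (min_le_right r ρ) hy)] at h1
    simpa only [sub_eq_add_neg] using (hasFDerivAt_comp_add_right (-y₀)).2
      (by simpa only [sub_eq_add_neg] using h1)
  exact ⟨min r ρ, lt_min hr hρ, hsub, fun y => u (y - y₀), by simpa using hu0,
    contDiffOn_of_hasFDerivAt_flip Metric.isOpen_ball (hA.mono hsub) hder, hder⟩

/-- Affine coordinates of a flat torsion-free connection with Christoffel symbols `G` on an open
subset of a vector space. -/
theorem exists_affine_coordinates {B : Set E} (hB : IsOpen B) {G : E → E →L[ℝ] E →L[ℝ] E}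
    (hG : ContDiffOn ℝ ∞ G B) (hsymm : ∀ x ∈ B, ∀ v w, G x v w = G x w v)
    (hflat : ∀ x ∈ B, ∀ v w f, fderiv ℝ G x v w f + G x v (G x w f) =
      fderiv ℝ G x w v f + G x w (G x v f)) {y₀ : E} (hy₀ : y₀ ∈ B) :
    ∃ φ : OpenPartialHomeomorph E E, y₀ ∈ φ.source ∧ φ.source ⊆ B ∧
      ContDiffOn ℝ ∞ φ φ.source ∧ ContDiffOn ℝ ∞ φ.symm φ.target ∧
      ∃ P : E → E →L[ℝ] E, ∀ y ∈ φ.source, HasFDerivAt φ (P y) y ∧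
        Function.Injective (P y) ∧
        HasFDerivAt P ((ContinuousLinearMap.compL ℝ E E E (P y)).comp (G y)) y := by
  set L := (ContinuousLinearMap.compL ℝ E E E).flip with hL
  have hLapp : ∀ f g, L g f = f.comp g := fun f g => rfl
  let A : E → E →L[ℝ] (E →L[ℝ] E) →L[ℝ] (E →L[ℝ] E) := fun y => L.comp (G y)
  have hA : ContDiffOn ℝ ∞ A B := contDiffOn_const.clm_comp hG
  have hdA : ∀ x ∈ B, ∀ v w f, fderiv ℝ A x v w f = f.comp (fderiv ℝ G x v w) := by
    intro x hx v w f
    have h1 : HasFDerivAt G (fderiv ℝ G x) x :=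
      ((hG.contDiffAt (hB.mem_nhds hx)).differentiableAt (by simp)).hasFDerivAt
    have h2 : HasFDerivAt A _ x := (hasFDerivAt_const L x).clm_comp h1
    rw [h2.fderiv]
    simp [hLapp]
  -- The unknown is `P` with `dP(v) = P ∘ G(v)` and `P(y₀) = id`. Composition on the right reverses
  -- products, so the two quadratic terms of the integrability condition are the products `G v ∘ G
  -- w` and `G w ∘ G v` of the flatness condition.
  obtain ⟨r, hr, hrB, P, hP0, hPs, hPd⟩ := exists_hasFDerivAt_of_integrable hB hA hy₀
    (fun x hx v w f => by
      rw [hdA x hx, hdA x hx]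
      ext k
      have := congrArg f (hflat x hx v w k)
      simpa [A, hLapp] using this) (ContinuousLinearMap.id ℝ E)
  have hPd' : ∀ y ∈ Metric.ball y₀ r,
      HasFDerivAt P ((ContinuousLinearMap.compL ℝ E E E (P y)).comp (G y)) y := hPd
  -- Since `dP(v) w = P (G v w)` is symmetric in `v` and `w`, the form `P` is closed and has a
  -- primitive `f` on the ball.
  obtain ⟨f, hf⟩ := (convex_ball y₀ r).exists_forall_hasFDerivAt_of_fderiv_symmetric
    Metric.isOpen_ball (fun y hy => (hPd' y hy).differentiableAt.differentiableWithinAt)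
    (fun y hy v w => by
      rw [(hPd' y hy).fderiv]
      simp [hsymm y (hrB hy) v w])
  have hfs : ContDiffOn ℝ ∞ f (Metric.ball y₀ r) :=
    contDiffOn_infty_of_hasFDerivAt Metric.isOpen_ball hf hPs
  have hy₀r : y₀ ∈ Metric.ball y₀ r := Metric.mem_ball_self hr
  have hf₀ : HasFDerivAt f ((ContinuousLinearEquiv.refl ℝ E : E ≃L[ℝ] E) : E →L[ℝ] E) y₀ := by
    have := hf y₀ hy₀r
    rwa [hP0] at this
  have hfat : ∀ y ∈ Metric.ball y₀ r, ContDiffAt ℝ ∞ f y := fun y hy =>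
    hfs.contDiffAt (Metric.isOpen_ball.mem_nhds hy)
  let φ₀ := (hfat y₀ hy₀r).toOpenPartialHomeomorph f hf₀ (by simp)
  -- The inverse function theorem uses invertibility of `P` only at `y₀`. Restricting to the open
  -- set where `P` stays invertible makes the inverse smooth on the whole target and `P` injective
  -- on the whole source.
  have hS : IsOpen (Metric.ball y₀ r ∩
      P ⁻¹' Set.range ((↑) : (E ≃L[ℝ] E) → E →L[ℝ] E)) :=
    hPs.continuousOn.isOpen_inter_preimage Metric.isOpen_ball ContinuousLinearEquiv.isOpen
  refine ⟨φ₀.restrOpen _ hS, ?_, ?_, ?_, ?_, P, ?_⟩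
  · refine ⟨(hfat y₀ hy₀r).mem_toOpenPartialHomeomorph_source hf₀ (by simp), hy₀r,
      ContinuousLinearEquiv.refl ℝ E, ?_⟩
    rw [hP0]; rfl
  · exact fun y hy => hrB hy.2.1
  · exact hfs.mono fun y hy => hy.2.1
  · intro a ha
    have hs := (φ₀.restrOpen _ hS).map_target ha
    obtain ⟨P', hP'⟩ := hs.2.2
    refine ((φ₀.restrOpen _ hS).contDiffAt_symm (f₀' := P') ha ?_
      (hfat _ hs.2.1)).contDiffWithinAt
    rw [hP']
    exact hf _ hs.2.1
  · intro y hy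
    obtain ⟨P', hP'⟩ := hy.2.2
    refine ⟨hf y hy.2.1, ?_, hPd' y hy.2.1⟩
    rw [← hP']
    exact P'.injective

end TotalDifferentialEquation

theorem fderiv_fderiv_apply_comm {E G : Type*} [NormedAddCommGroup E] [NormedSpace ℝ E]
    [NormedAddCommGroup G] [NormedSpace ℝ G] {K : E → G} {z : E} (hK : ContDiffAt ℝ ∞ K z)
    (a b : E) :
    fderiv ℝ (fun w => fderiv ℝ K w a) z b = fderiv ℝ (fun w => fderiv ℝ K w b) z a := by
  have hd : DifferentiableAt ℝ (fderiv ℝ K) z :=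
    (hK.fderiv_right (m := ∞) (by simp)).differentiableAt (by simp)
  have h1 : ∀ c, fderiv ℝ (fun w => fderiv ℝ K w c) z = (fderiv ℝ (fderiv ℝ K) z).flip c := by
    intro c
    have : HasFDerivAt (fun w => fderiv ℝ K w c) _ z :=
      hd.hasFDerivAt.clm_apply (hasFDerivAt_const c z)
    rw [this.fderiv, ContinuousLinearMap.comp_zero, zero_add]
  have hsymm : IsSymmSndFDerivAt ℝ K z :=
    hK.isSymmSndFDerivAt (by rw [minSmoothness_of_isRCLikeNormedField]; exact ENat.LEInfty.out)
  rw [h1, h1, ContinuousLinearMap.flip_apply, ContinuousLinearMap.flip_apply, hsymm.eq]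

theorem fderiv_snd_apply_apply {E Y Z W : Type*} [NormedAddCommGroup E] [NormedSpace ℝ E]
    [NormedAddCommGroup Y] [NormedSpace ℝ Y] [NormedAddCommGroup Z] [NormedSpace ℝ Z]
    [NormedAddCommGroup W] [NormedSpace ℝ W] {Γ : Y → Y →L[ℝ] Z →L[ℝ] W} {w : E × Y}
    (hΓ : DifferentiableAt ℝ Γ w.2) (a : Y) (b : Z) (v : E × Y) :
    fderiv ℝ (fun w : E × Y => Γ w.2 a b) w v = fderiv ℝ Γ w.2 v.2 a b := by
  have h0 : HasFDerivAt (fun w : E × Y => Γ w.2) _ w :=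
    HasFDerivAt.comp (g := Γ) (f := Prod.snd) w hΓ.hasFDerivAt hasFDerivAt_snd
  have h1 : HasFDerivAt (fun w : E × Y => Γ w.2 a) _ w := h0.clm_apply (hasFDerivAt_const a w)
  have h2 : HasFDerivAt (fun w : E × Y => Γ w.2 a b) _ w := h1.clm_apply (hasFDerivAt_const b w)
  rw [h2.fderiv]
  simp

/-! ### Coordinate fields and differentials in a chart -/

section ChartCalculus

variable {p q : ℕ} {M : Type*} [TopologicalSpace M] [ChartedSpace (FolModel p q) M]
  [IsManifold (folI p q) ∞ M] {e : OpenPartialHomeomorph M (FolModel p q)} {x : M}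

theorem mdifferentiable_of_mem_maximalAtlas (he : e ∈ IsManifold.maximalAtlas (folI p q) ∞ M) :
    e.MDifferentiable (folI p q) (folI p q) :=
  ⟨(contMDiffOn_of_mem_maximalAtlas he).mdifferentiableOn (by simp),
    (contMDiffOn_symm_of_mem_maximalAtlas he).mdifferentiableOn (by simp)⟩

theorem isInvertible_mfderiv_chart (he : e ∈ IsManifold.maximalAtlas (folI p q) ∞ M)
    (hx : x ∈ e.source) : (mfderiv (folI p q) (folI p q) e x).IsInvertible :=
  ⟨(mdifferentiable_of_mem_maximalAtlas he).mfderiv hx, rfl⟩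

theorem transDiff_apply (he : e ∈ IsManifold.maximalAtlas (folI p q) ∞ M)
    (hx : x ∈ e.source) (v : TangentSpace (folI p q) x) :
    transDiff e x v = (mfderiv (folI p q) (folI p q) e x v : FolModel p q).2 := by
  have h1 : HasMFDerivAt (folI p q) (folI p q) e x (mfderiv (folI p q) (folI p q) e x) :=
    ((mdifferentiable_of_mem_maximalAtlas he).mdifferentiableAt hx).hasMFDerivAt
  have h2 : HasMFDerivAt (folI p q) 𝓘(ℝ, EuclideanSpace ℝ (Fin q))
      (Prod.snd : FolModel p q → EuclideanSpace ℝ (Fin q)) (e x)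
      (ContinuousLinearMap.snd ℝ (EuclideanSpace ℝ (Fin p)) (EuclideanSpace ℝ (Fin q))) :=
    hasFDerivAt_snd.hasMFDerivAt
  have h3 := (h2.comp x h1).mfderiv
  exact congrArg (fun L : TangentSpace (folI p q) x →L[ℝ] EuclideanSpace ℝ (Fin q) => L v) h3

/-- The vector field with constant components `c` in the chart `e` (used on `e.source` only). -/
def constField (e : OpenPartialHomeomorph M (FolModel p q)) (c : FolModel p q) (x : M) :
    TangentSpace (folI p q) x :=
  VectorField.mpullback (folI p q) (folI p q) e (fun _ => c) x

theorem coordVec_eq_constField (i : Fin q) :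
    coordVec e i = constField e (0, EuclideanSpace.single i 1) := rfl

theorem constField_add (c c' : FolModel p q) :
    constField e (c + c') x = constField e c x + constField e c' x :=
  map_add (mfderiv (folI p q) (folI p q) e x).inverse c c'

theorem constField_smul (a : ℝ) (c : FolModel p q) :
    constField e (a • c) x = a • constField e c x :=
  map_smul (mfderiv (folI p q) (folI p q) e x).inverse a c

theorem mfderiv_constField (he : e ∈ IsManifold.maximalAtlas (folI p q) ∞ M)
    (hx : x ∈ e.source) (c : FolModel p q) :
    mfderiv (folI p q) (folI p q) e x (constField e c x) = c :=
  (isInvertible_mfderiv_chart he hx).self_apply_inverse c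

theorem constField_mfderiv (he : e ∈ IsManifold.maximalAtlas (folI p q) ∞ M)
    (hx : x ∈ e.source) (v : TangentSpace (folI p q) x) :
    constField e (mfderiv (folI p q) (folI p q) e x v) x = v :=
  (isInvertible_mfderiv_chart he hx).inverse_apply_self v

theorem contMDiff_const_section (c : FolModel p q) :
    ContMDiff (folI p q) (folI p q).tangent ∞
      (fun y => (⟨y, c⟩ : TangentBundle (folI p q) (FolModel p q))) :=
  fun _ => contMDiffAt_vectorSpace_iff_contDiffAt.2 contDiffAt_const

theorem smoothFieldOn_constField (he : e ∈ IsManifold.maximalAtlas (folI p q) ∞ M)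
    (c : FolModel p q) : SmoothFieldOn (constField e c) e.source := fun x hx =>
  (ContMDiffAt.mpullback_vectorField_preimage (n := ∞) (contMDiff_const_section c _)
    (contMDiffAt_of_mem_maximalAtlas he hx) (isInvertible_mfderiv_chart he hx)
    (by simp)).contMDiffWithinAt

/-- The bracket commutes with pullback, and the bracket of constant fields on a vector space is
zero. -/
theorem mlieBracket_constField (he : e ∈ IsManifold.maximalAtlas (folI p q) ∞ M)
    (hx : x ∈ e.source) (c c' : FolModel p q) :
    VectorField.mlieBracket (folI p q) (constField e c) (constField e c') x = 0 := by
  have : IsManifold (folI p q) (minSmoothness ℝ 2) M := by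
    rw [minSmoothness_of_isRCLikeNormedField]; infer_instance
  have h2 : minSmoothness ℝ 2 ≤ (∞ : ℕ∞ω) := by
    rw [minSmoothness_of_isRCLikeNormedField]; exact ENat.LEInfty.out
  let V : ∀ y : FolModel p q, TangentSpace (folI p q) y := fun _ => c
  let W : ∀ y : FolModel p q, TangentSpace (folI p q) y := fun _ => c'
  have h := VectorField.mpullback_mlieBracket (n := ∞) (V := V) (W := W)
    ((contMDiff_const_section c).mdifferentiableAt (by simp))
    ((contMDiff_const_section c').mdifferentiableAt (by simp))
    (contMDiffAt_of_mem_maximalAtlas he hx) h2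
  refine Eq.trans h.symm ?_
  have h0 : VectorField.mlieBracket (folI p q) V W (e x) = 0 := by
    rw [← VectorField.mlieBracketWithin_univ, VectorField.mlieBracketWithin_eq_lieBracketWithin,
      VectorField.lieBracketWithin_univ]
    exact (by simp [VectorField.lieBracket_eq] :
      VectorField.lieBracket ℝ (fun _ : FolModel p q => c) (fun _ => c') (e x) = 0)
  rw [VectorField.mpullback_apply, h0]
  exact map_zero _

variable {G : Type*} [NormedAddCommGroup G] [NormedSpace ℝ G] {f : M → G}

theorem contMDiffAt_iff_chart (he : e ∈ IsManifold.maximalAtlas (folI p q) ∞ M)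
    (hx : x ∈ e.source) :
    ContMDiffAt (folI p q) 𝓘(ℝ, G) ∞ f x ↔ ContDiffAt ℝ ∞ (fun w => f (e.symm w)) (e x) := by
  rw [← contMDiffAt_iff_contDiffAt]
  constructor
  · intro h
    rw [← e.left_inv hx] at h
    exact h.comp (e x) (contMDiffAt_symm_of_mem_maximalAtlas he (e.map_source hx))
  · intro h
    refine (h.comp x (contMDiffAt_of_mem_maximalAtlas he hx)).congr_of_eventuallyEq ?_
    filter_upwards [e.open_source.mem_nhds hx] with z hz
    simp [e.left_inv hz]

theorem mfderiv_eq_fderiv_chart (he : e ∈ IsManifold.maximalAtlas (folI p q) ∞ M)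
    (hx : x ∈ e.source) (hf : MDifferentiableAt (folI p q) 𝓘(ℝ, G) f x)
    (v : TangentSpace (folI p q) x) :
    mfderiv (folI p q) 𝓘(ℝ, G) f x v = fderiv ℝ (fun w => f (e.symm w)) (e x)
      (mfderiv (folI p q) (folI p q) e x v) := by
  have hd := mdifferentiable_of_mem_maximalAtlas he
  have hf' : MDifferentiableAt (folI p q) 𝓘(ℝ, G) f (e.symm (e x)) := by rwa [e.left_inv hx]
  have h1 : MDifferentiableAt (folI p q) 𝓘(ℝ, G) (f ∘ e.symm) (e x) :=
    hf'.comp (e x) (hd.mdifferentiableAt_symm (e.map_source hx))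
  have h2 := mfderiv_comp x h1 (hd.mdifferentiableAt hx)
  have h3 : mfderiv (folI p q) 𝓘(ℝ, G) ((f ∘ e.symm) ∘ e) x = mfderiv (folI p q) 𝓘(ℝ, G) f x := by
    refine Filter.EventuallyEq.mfderiv_eq ?_
    filter_upwards [e.open_source.mem_nhds hx] with z hz
    simp [e.left_inv hz]
  have h4 : mfderiv (folI p q) 𝓘(ℝ, G) f x = (mfderiv (folI p q) 𝓘(ℝ, G) (f ∘ e.symm) (e x)).comp
      (mfderiv (folI p q) (folI p q) e x) := h3.symm.trans h2
  rw [h4, mfderiv_eq_fderiv]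
  rfl

theorem smoothFunOn_iff {V : Set M} (hV : IsOpen V) {f : M → ℝ} :
    SmoothFunOn (p := p) (q := q) f V ↔ ∀ x ∈ V, ContMDiffAt (folI p q) 𝓘(ℝ, ℝ) ∞ f x :=
  ⟨fun h x hx => h.contMDiffAt (hV.mem_nhds hx), fun h x hx => (h x hx).contMDiffWithinAt⟩

theorem funDiff_eq_fderiv_chart (he : e ∈ IsManifold.maximalAtlas (folI p q) ∞ M)
    (hx : x ∈ e.source) {f : M → ℝ} (hf : ContMDiffAt (folI p q) 𝓘(ℝ, ℝ) ∞ f x)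
    (v : TangentSpace (folI p q) x) :
    funDiff (p := p) (q := q) f x v = fderiv ℝ (fun w => f (e.symm w)) (e x)
      (mfderiv (folI p q) (folI p q) e x v) :=
  mfderiv_eq_fderiv_chart he hx (hf.mdifferentiableAt (by simp)) v

theorem partialY_eq_funDiff (he : e ∈ IsManifold.maximalAtlas (folI p q) ∞ M)
    (hx : x ∈ e.source) {f : M → ℝ} (hf : ContMDiffAt (folI p q) 𝓘(ℝ, ℝ) ∞ f x) (i : Fin q) :
    partialY e f i x = funDiff (p := p) (q := q) f x (coordVec e i x) := by
  rw [funDiff_eq_fderiv_chart he hx hf, coordVec_eq_constField, mfderiv_constField he hx]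
  rfl

end ChartCalculus

/-! ### Basic functions and foliated sections in adapted charts -/

namespace Foliation

variable {p q : ℕ} {M : Type*} [TopologicalSpace M] [ChartedSpace (FolModel p q) M]
  [IsManifold (folI p q) ∞ M] {F : Foliation p q M} {e e' : OpenPartialHomeomorph M (FolModel p q)}
  {x : M}

theorem IsAdapted.mem_tangent_iff (he : F.IsAdapted e) (hx : x ∈ e.source)
    {v : TangentSpace (folI p q) x} :
    v ∈ F.tangent x ↔ (mfderiv (folI p q) (folI p q) e x v : FolModel p q).2 = 0 := by
  rw [he.2 x hx, LinearMap.mem_ker, transDiff_apply he.1 hx]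

theorem coeff_bar (he : F.IsAdapted e) (hx : x ∈ e.source) (v : TangentSpace (folI p q) x) :
    F.coeff e x (F.bar x v) = (mfderiv (folI p q) (folI p q) e x v : FolModel p q).2 := by
  rw [← transDiff_apply he.1 hx, coeff, dif_pos (he.2 x hx).le]
  rfl

theorem bar_surjective (n : F.Normal x) : ∃ v, F.bar x v = n := Submodule.mkQ_surjective _ n

theorem coeff_injective (he : F.IsAdapted e) (hx : x ∈ e.source) :
    Function.Injective (F.coeff e x) := by
  rw [injective_iff_map_eq_zero]
  intro n hn
  obtain ⟨v, rfl⟩ := bar_surjective n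
  rw [coeff_bar he hx, ← he.mem_tangent_iff hx] at hn
  exact (Submodule.Quotient.mk_eq_zero _).2 hn

/-- The section of the normal bundle with constant components `w` in the chart `e`. -/
def constSection (F : Foliation p q M) (e : OpenPartialHomeomorph M (FolModel p q))
    (w : EuclideanSpace ℝ (Fin q)) (x : M) : F.Normal x :=
  F.bar x (constField e (0, w) x)

theorem coordSection_eq_constSection (i : Fin q) :
    F.coordSection e i = F.constSection e (EuclideanSpace.single i 1) := rfl

theorem coeff_constSection (he : F.IsAdapted e) (hx : x ∈ e.source)
    (w : EuclideanSpace ℝ (Fin q)) : F.coeff e x (F.constSection e w x) = w := by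
  rw [constSection, coeff_bar he hx, mfderiv_constField he.1 hx]

theorem constSection_coeff (he : F.IsAdapted e) (hx : x ∈ e.source) (n : F.Normal x) :
    F.constSection e (F.coeff e x n) x = n :=
  coeff_injective he hx (coeff_constSection he hx _)

theorem bar_constField (he : F.IsAdapted e) (hx : x ∈ e.source) (c : FolModel p q) :
    F.bar x (constField e c x) = F.constSection e c.2 x := by
  apply coeff_injective he hx
  rw [coeff_bar he hx, mfderiv_constField he.1 hx, coeff_constSection he hx]

theorem constSection_add (w w' : EuclideanSpace ℝ (Fin q)) :
    F.constSection e (w + w') x = F.constSection e w x + F.constSection e w' x := by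
  have : ((0, w + w') : FolModel p q) = (0, w) + (0, w') := by simp
  rw [constSection, this, constField_add, map_add]; rfl

theorem constSection_smul (a : ℝ) (w : EuclideanSpace ℝ (Fin q)) :
    F.constSection e (a • w) x = a • F.constSection e w x := by
  have : ((0, a • w) : FolModel p q) = a • (0, w) := by simp
  rw [constSection, this, constField_smul, map_smul]; rfl

/-- `constSection` as a linear map. -/
def constSectionₗ (F : Foliation p q M) (e : OpenPartialHomeomorph M (FolModel p q)) (x : M) :
    EuclideanSpace ℝ (Fin q) →ₗ[ℝ] F.Normal x where
  toFun w := F.constSection e w x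
  map_add' := constSection_add
  map_smul' := constSection_smul

theorem euclidean_eq_sum (w : EuclideanSpace ℝ (Fin q)) :
    w = ∑ i, w i • EuclideanSpace.single i (1 : ℝ) := by
  ext j
  simp [Finset.sum_apply, Pi.single_apply]

theorem constSection_eq_sum (w : EuclideanSpace ℝ (Fin q)) :
    F.constSection e w x = ∑ i, w i • F.coordSection e i x := by
  have h := congrArg (F.constSectionₗ e x) (euclidean_eq_sum w)
  simp only [map_sum, map_smul] at h
  exact h

theorem eq_sum_coordSection (he : F.IsAdapted e) (hx : x ∈ e.source) (n : F.Normal x) :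
    n = ∑ i, F.coeff e x n i • F.coordSection e i x := by
  rw [← constSection_eq_sum, constSection_coeff he hx]

/-- Smoothness near `x` and vanishing differential along the leaf at `x`. -/
def BasicAt (F : Foliation p q M) (f : M → ℝ) (x : M) : Prop :=
  ContMDiffAt (folI p q) 𝓘(ℝ, ℝ) ∞ f x ∧
    ∀ v ∈ F.tangent x, funDiff (p := p) (q := q) f x v = 0

theorem isBasicOn_iff {V : Set M} (hV : IsOpen V) {f : M → ℝ} :
    F.IsBasicOn f V ↔ ∀ x ∈ V, F.BasicAt f x := by
  rw [IsBasicOn, smoothFunOn_iff hV]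
  exact ⟨fun h x hx => ⟨h.1 x hx, h.2 x hx⟩, fun h => ⟨fun x hx => (h x hx).1, fun x hx => (h x hx).2⟩⟩

theorem funDiff_congr {f g : M → ℝ} (h : f =ᶠ[𝓝 x] g) :
    funDiff (p := p) (q := q) f x = funDiff (p := p) (q := q) g x := by
  rw [funDiff, funDiff]
  ext v
  exact congrArg (fun L : TangentSpace (folI p q) x →L[ℝ] ℝ => L v) h.mfderiv_eq

theorem BasicAt.congr {f g : M → ℝ} (hf : F.BasicAt f x) (h : g =ᶠ[𝓝 x] f) : F.BasicAt g x :=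
  ⟨hf.1.congr_of_eventuallyEq h, fun v hv => by rw [funDiff_congr h]; exact hf.2 v hv⟩

theorem basicAt_iff_chart (he : F.IsAdapted e) (hx : x ∈ e.source) {f : M → ℝ} :
    F.BasicAt f x ↔ ContDiffAt ℝ ∞ (fun w => f (e.symm w)) (e x) ∧
      ∀ a, fderiv ℝ (fun w => f (e.symm w)) (e x) (a, 0) = 0 := by
  rw [BasicAt, contMDiffAt_iff_chart he.1 hx]
  refine and_congr_right fun hf => ?_
  rw [← contMDiffAt_iff_chart he.1 hx] at hf
  constructor
  · intro h a
    have := h (constField e (a, 0) x)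
      ((he.mem_tangent_iff hx).2 (by rw [mfderiv_constField he.1 hx]))
    rwa [funDiff_eq_fderiv_chart he.1 hx hf, mfderiv_constField he.1 hx] at this
  · intro h v hv
    rw [funDiff_eq_fderiv_chart he.1 hx hf]
    have h2 := (he.mem_tangent_iff hx).1 hv
    have h3 : mfderiv (folI p q) (folI p q) e x v =
      ((mfderiv (folI p q) (folI p q) e x v : FolModel p q).1, 0) := Prod.ext rfl h2
    rw [h3]
    exact h _

theorem basicAt_const (c : ℝ) : F.BasicAt (fun _ => c) x := by
  obtain ⟨e, hx, he⟩ := F.exists_adapted x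
  rw [basicAt_iff_chart (e := e) he hx]
  exact ⟨contDiffAt_const, by simp⟩

theorem BasicAt.mul {f g : M → ℝ} (hf : F.BasicAt f x) (hg : F.BasicAt g x) :
    F.BasicAt (fun z => f z * g z) x := by
  obtain ⟨e, hx, he⟩ := F.exists_adapted x
  rw [basicAt_iff_chart (e := e) he hx] at hf hg ⊢
  refine ⟨hf.1.mul hg.1, fun a => ?_⟩
  rw [fderiv_fun_mul (hf.1.differentiableAt (by simp)) (hg.1.differentiableAt (by simp))]
  simp [hf.2, hg.2]

theorem BasicAt.sum {ι : Type*} {s : Finset ι} {f : ι → M → ℝ} (hf : ∀ i ∈ s, F.BasicAt (f i) x) :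
    F.BasicAt (fun z => ∑ i ∈ s, f i z) x := by
  obtain ⟨e, hx, he⟩ := F.exists_adapted x
  simp only [basicAt_iff_chart (e := e) he hx] at hf ⊢
  refine ⟨ContDiffAt.sum fun i hi => (hf i hi).1, fun a => ?_⟩
  rw [fderiv_fun_sum fun i hi => (hf i hi).1.differentiableAt (by simp)]
  simp only [sum_apply]
  exact Finset.sum_eq_zero fun i hi => (hf i hi).2 a

theorem hasFDerivAt_snd_apply (i : Fin q) (w₀ : FolModel p q) :
    HasFDerivAt (fun w : FolModel p q => w.2 i)
      ((EuclideanSpace.proj i).comp (ContinuousLinearMap.snd ℝ _ _)) w₀ :=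
  ((EuclideanSpace.proj i : EuclideanSpace ℝ (Fin q) →L[ℝ] ℝ).comp
    (ContinuousLinearMap.snd ℝ (EuclideanSpace ℝ (Fin p)) _)).hasFDerivAt

theorem basicAt_chart_comp (he : F.IsAdapted e) (hx : x ∈ e.source) (i : Fin q) :
    F.BasicAt (fun z => (e z).2 i) x := by
  rw [basicAt_iff_chart he hx]
  have h : (fun w => (e (e.symm w)).2 i) =ᶠ[𝓝 (e x)] fun w => w.2 i := by
    filter_upwards [e.open_target.mem_nhds (e.map_source hx)] with w hw
    rw [e.right_inv hw]
  have h1 : ContDiff ℝ ∞ fun w : FolModel p q => w.2 i := by fun_prop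
  refine ⟨h1.contDiffAt.congr_of_eventuallyEq h, fun a => ?_⟩
  rw [h.fderiv_eq, (hasFDerivAt_snd_apply i _).fderiv]
  simp

/-- The derivative of a basic function along a coordinate field of an adapted chart is basic. -/
theorem BasicAt.funDiff_constField (he : F.IsAdapted e) (hx : x ∈ e.source) {f : M → ℝ}
    (hf : ∀ᶠ z in 𝓝 x, F.BasicAt f z) (c : FolModel p q) :
    F.BasicAt (fun z => funDiff (p := p) (q := q) f z (constField e c z)) x := by
  have hev : ∀ᶠ w in 𝓝 (e x), w ∈ e.target ∧ F.BasicAt f (e.symm w) := by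
    refine (e.open_target.eventually_mem (e.map_source hx)).and ?_
    have : Filter.Tendsto e.symm (𝓝 (e x)) (𝓝 x) := by
      have := (e.continuousAt_symm (e.map_source hx)).tendsto
      rwa [e.left_inv hx] at this
    exact this.eventually hf
  set τ := fun w => f (e.symm w) with hτ
  have heq : (fun w => funDiff (p := p) (q := q) f (e.symm w) (constField e c (e.symm w)))
      =ᶠ[𝓝 (e x)] fun w => fderiv ℝ τ w c := by
    filter_upwards [hev] with w hw
    have hs := e.map_target hw.1
    rw [funDiff_eq_fderiv_chart he.1 hs hw.2.1, mfderiv_constField he.1 hs, e.right_inv hw.1]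
  have hτs : ContDiffAt ℝ ∞ τ (e x) := ((basicAt_iff_chart he hx).1 hf.self_of_nhds).1
  have hτ2 : ContDiffAt ℝ ∞ (fderiv ℝ τ) (e x) := hτs.fderiv_right (by simp)
  rw [basicAt_iff_chart he hx]
  refine ⟨(hτ2.clm_apply contDiffAt_const).congr_of_eventuallyEq heq, fun a => ?_⟩
  rw [heq.fderiv_eq]
  -- After exchanging the two derivatives, the inner one is along the leaf; it vanishes near the
  -- point and not merely at it.
  rw [fderiv_fderiv_apply_comm hτs]
  have h0 : (fun w => fderiv ℝ τ w (a, 0)) =ᶠ[𝓝 (e x)] fun _ => 0 := by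
    filter_upwards [hev] with w hw
    have := ((basicAt_iff_chart he (e.map_target hw.1)).1 hw.2).2 a
    rwa [e.right_inv hw.1] at this
  rw [h0.fderiv_eq]
  simp

/-- The component is the derivative of the basic function `y'ʲ`, a transverse coordinate of `e'`,
along a coordinate field of `e`. Hence transverse transition matrices are basic, and foliatedness
can be tested in a single chart. -/
theorem basicAt_coeff_constSection (he : F.IsAdapted e) (he' : F.IsAdapted e') (hx : x ∈ e.source)
    (hx' : x ∈ e'.source) (w : EuclideanSpace ℝ (Fin q)) (j : Fin q) :
    F.BasicAt (fun z => F.coeff e' z (F.constSection e w z) j) x := by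
  have hb : ∀ z ∈ e'.source, F.BasicAt (fun z => (e' z).2 j) z := fun z hz =>
    basicAt_chart_comp he' hz j
  refine (BasicAt.funDiff_constField he hx (f := fun z => (e' z).2 j)
    (Filter.eventually_of_mem (e'.open_source.mem_nhds hx') hb) (0, w)).congr ?_
  filter_upwards [e'.open_source.mem_nhds hx'] with z hz
  rw [constSection, coeff_bar he' hz, funDiff_eq_fderiv_chart he'.1 hz (hb z hz).1]
  have h : (fun w => (e' (e'.symm w)).2 j) =ᶠ[𝓝 (e' z)] fun w => w.2 j := by
    filter_upwards [e'.open_target.mem_nhds (e'.map_source hz)] with w hw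
    rw [e'.right_inv hw]
  rw [h.fderiv_eq, (hasFDerivAt_snd_apply j _).fderiv]
  rfl

theorem coeff_eq_sum (he : F.IsAdapted e) (hx : x ∈ e.source) (n : F.Normal x) (j : Fin q) :
    F.coeff e' x n j = ∑ i, F.coeff e x n i * F.coeff e' x (F.coordSection e i x) j := by
  conv_lhs => rw [eq_sum_coordSection he hx n]
  simp

/-- A section is foliated over a subset of the domain of an adapted chart if its components in
that chart are basic. -/
theorem isFoliatedOn_of_chart (he : F.IsAdapted e) {V : Set M} (hV : IsOpen V)
    (hVe : V ⊆ e.source) {s : ∀ x, F.Normal x}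
    (hs : ∀ i, ∀ x ∈ V, F.BasicAt (fun z => F.coeff e z (s z) i) x) : F.IsFoliatedOn s V := by
  intro e' he' j
  rw [isBasicOn_iff (hV.inter e'.open_source)]
  intro x hx
  refine (BasicAt.sum (s := Finset.univ) fun i _ => (hs i x hx.1).mul
    (basicAt_coeff_constSection he he' (hVe hx.1) hx.2 (EuclideanSpace.single i 1) j)).congr ?_
  filter_upwards [hV.mem_nhds hx.1] with z hz
  exact coeff_eq_sum he (hVe hz) (s z) j

theorem IsFoliatedOn.basicAt {V : Set M} (hV : IsOpen V) {s : ∀ x, F.Normal x}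
    (hs : F.IsFoliatedOn s V) (he : F.IsAdapted e) (hxV : x ∈ V) (hx : x ∈ e.source) (i : Fin q) :
    F.BasicAt (fun z => F.coeff e z (s z) i) x :=
  (isBasicOn_iff (hV.inter e.open_source)).1 (hs e he i) x ⟨hxV, hx⟩

theorem IsSmoothOn.contMDiffAt {V : Set M} (hV : IsOpen V) {s : ∀ x, F.Normal x}
    (hs : F.IsSmoothOn s V) (he : F.IsAdapted e) (hxV : x ∈ V) (hx : x ∈ e.source) (i : Fin q) :
    ContMDiffAt (folI p q) 𝓘(ℝ, ℝ) ∞ (fun z => F.coeff e z (s z) i) x :=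
  (smoothFunOn_iff (hV.inter e.open_source)).1 (hs e he i) x ⟨hxV, hx⟩

theorem IsFoliatedOn.isSmoothOn {V : Set M} {s : ∀ x, F.Normal x} (hs : F.IsFoliatedOn s V) :
    F.IsSmoothOn s V := fun e he i => (hs e he i).1

theorem IsSmoothOn.mono {V W : Set M} {s : ∀ x, F.Normal x} (hs : F.IsSmoothOn s V) (h : W ⊆ V) :
    F.IsSmoothOn s W := fun e he i =>
  ContMDiffOn.mono (hs e he i) (Set.inter_subset_inter_left _ h)

theorem IsFoliatedOn.mono {V W : Set M} {s : ∀ x, F.Normal x} (hs : F.IsFoliatedOn s V)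
    (h : W ⊆ V) : F.IsFoliatedOn s W := fun e he i =>
  ⟨ContMDiffOn.mono (hs e he i).1 (Set.inter_subset_inter_left _ h),
    fun x hx => (hs e he i).2 x ⟨h hx.1, hx.2⟩⟩

theorem isFoliatedOn_constSection (he : F.IsAdapted e) (w : EuclideanSpace ℝ (Fin q)) :
    F.IsFoliatedOn (F.constSection e w) e.source :=
  isFoliatedOn_of_chart he e.open_source subset_rfl fun i x hx =>
    basicAt_coeff_constSection he he hx hx w i

theorem isInfAutOn_constField (he : F.IsAdapted e) (c : FolModel p q) :
    F.IsInfAutOn (constField e c) e.source := by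
  refine ⟨smoothFieldOn_constField he.1 c, isFoliatedOn_of_chart he e.open_source subset_rfl
    fun i x hx => (basicAt_const (c.2 i)).congr ?_⟩
  filter_upwards [e.open_source.mem_nhds hx] with z hz
  rw [bar_constField he hz, coeff_constSection he hz]

theorem isSmoothOn_constSection (he : F.IsAdapted e) (w : EuclideanSpace ℝ (Fin q)) :
    F.IsSmoothOn (F.constSection e w) e.source := (isFoliatedOn_constSection he w).isSmoothOn

theorem funDiff_const (c : ℝ) (v : TangentSpace (folI p q) x) :
    funDiff (p := p) (q := q) (fun _ => c) x v = 0 := by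
  have : mfderiv (folI p q) 𝓘(ℝ, ℝ) (fun _ : M => c) x = 0 := mfderiv_const
  exact congrArg (fun L : TangentSpace (folI p q) x →L[ℝ] ℝ => L v) this

/-- The components of a section in a chart, as a function on the model space. -/
def coeffIn (F : Foliation p q M) (e : OpenPartialHomeomorph M (FolModel p q))
    (s : ∀ x, F.Normal x) (w : FolModel p q) : EuclideanSpace ℝ (Fin q) :=
  F.coeff e (e.symm w) (s (e.symm w))

theorem IsSmoothOn.contDiffAt_coeffIn {V : Set M} (hV : IsOpen V) {s : ∀ x, F.Normal x}
    (hs : F.IsSmoothOn s V) (he : F.IsAdapted e) (hxV : x ∈ V) (hx : x ∈ e.source) :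
    ContDiffAt ℝ ∞ (F.coeffIn e s) (e x) :=
  contDiffAt_euclidean.2 fun i =>
    (contMDiffAt_iff_chart he.1 hx).1 (hs.contMDiffAt hV he hxV hx i)

theorem funDiff_coeff {V : Set M} (hV : IsOpen V) {s : ∀ x, F.Normal x}
    (hs : F.IsSmoothOn s V) (he : F.IsAdapted e) (hxV : x ∈ V) (hx : x ∈ e.source) (i : Fin q)
    (v : TangentSpace (folI p q) x) :
    funDiff (p := p) (q := q) (fun z => F.coeff e z (s z) i) x v =
      fderiv ℝ (F.coeffIn e s) (e x) (mfderiv (folI p q) (folI p q) e x v) i := by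
  rw [funDiff_eq_fderiv_chart he.1 hx (hs.contMDiffAt hV he hxV hx i)]
  have h := ((hs.contDiffAt_coeffIn hV he hxV hx).differentiableAt (by simp)).hasFDerivAt
  have h2 : HasFDerivAt (fun w => F.coeffIn e s w i)
      ((EuclideanSpace.proj i : EuclideanSpace ℝ (Fin q) →L[ℝ] ℝ).comp
        (fderiv ℝ (F.coeffIn e s) (e x))) (e x) :=
    (EuclideanSpace.proj i : EuclideanSpace ℝ (Fin q) →L[ℝ] ℝ).hasFDerivAt.comp (e x) h
  have h3 := h2.fderiv
  rw [show (fun w => F.coeff e (e.symm w) (s (e.symm w)) i) = fun w => F.coeffIn e s w i from rfl,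
    h3]
  rfl

/-! ### Connections in components and the difference tensor -/

namespace NormalConnection

variable (D nabla : F.NormalConnection)

theorem isSmoothOn_zero (V : Set M) : F.IsSmoothOn (fun _ => 0) V := by
  intro e he i
  have : (fun x => F.coeff e x (0 : F.Normal x) i) = fun _ => (0 : ℝ) := by
    funext x; simp
  rw [this]
  exact contMDiffOn_const

theorem toFun_zero (v : TangentSpace (folI p q) x) : D.toFun (fun _ => 0) x v = 0 := by
  have h := D.leibniz' (f := fun _ => (0 : ℝ)) (s := fun _ => 0) isOpen_univ contMDiffOn_const
    (isSmoothOn_zero _) x (Set.mem_univ x) v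
  simpa using h

theorem toFun_const_smul {V : Set M} (hV : IsOpen V) {s : ∀ x, F.Normal x} (hs : F.IsSmoothOn s V)
    (hx : x ∈ V) (a : ℝ) (v : TangentSpace (folI p q) x) :
    D.toFun (fun z => a • s z) x v = a • D.toFun s x v := by
  have h := D.leibniz' (f := fun _ => a) hV contMDiffOn_const hs x hx v
  rw [funDiff_const, zero_smul, add_zero] at h
  exact h

theorem toFun_constSection_add (he : F.IsAdapted e) (hx : x ∈ e.source)
    (w w' : EuclideanSpace ℝ (Fin q)) (v : TangentSpace (folI p q) x) :
    D.toFun (F.constSection e (w + w')) x v =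
      D.toFun (F.constSection e w) x v + D.toFun (F.constSection e w') x v := by
  have h := D.add' e.open_source (isSmoothOn_constSection he w) (isSmoothOn_constSection he w') x hx
  have h2 : F.constSection e (w + w') = fun z => F.constSection e w z + F.constSection e w' z :=
    funext fun z => constSection_add w w'
  rw [h2, h, LinearMap.add_apply]

theorem toFun_constSection_smul (he : F.IsAdapted e) (hx : x ∈ e.source) (a : ℝ)
    (w : EuclideanSpace ℝ (Fin q)) (v : TangentSpace (folI p q) x) :
    D.toFun (F.constSection e (a • w)) x v = a • D.toFun (F.constSection e w) x v := by
  have h2 : F.constSection e (a • w) = fun z => a • F.constSection e w z :=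
    funext fun z => constSection_smul a w
  rw [h2, D.toFun_const_smul e.open_source (isSmoothOn_constSection he w) hx]

theorem toFun_constSection_eq_sum (he : F.IsAdapted e) (hx : x ∈ e.source)
    (w : EuclideanSpace ℝ (Fin q)) (v : TangentSpace (folI p q) x) :
    D.toFun (F.constSection e w) x v = ∑ i, w i • D.toFun (F.coordSection e i) x v := by
  let L : EuclideanSpace ℝ (Fin q) →ₗ[ℝ] F.Normal x :=
    { toFun := fun w => D.toFun (F.constSection e w) x v
      map_add' := fun w w' => D.toFun_constSection_add he hx w w' v
      map_smul' := fun a w => D.toFun_constSection_smul he hx a w v }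
  have h := congrArg L (euclidean_eq_sum w)
  simp only [map_sum, map_smul] at h
  exact h

theorem isSmoothOn_smul {V : Set M} {f : M → ℝ} {s : ∀ x, F.Normal x}
    (hf : SmoothFunOn (p := p) (q := q) f V) (hs : F.IsSmoothOn s V) :
    F.IsSmoothOn (fun z => f z • s z) V := by
  intro e he i
  have : (fun x => F.coeff e x (f x • s x) i) = fun x => f x * F.coeff e x (s x) i := by
    funext x; simp
  rw [this]
  exact ContMDiffOn.mul (ContMDiffOn.mono hf Set.inter_subset_left) (hs e he i)

theorem isSmoothOn_add {V : Set M} {s t : ∀ x, F.Normal x}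
    (hs : F.IsSmoothOn s V) (ht : F.IsSmoothOn t V) : F.IsSmoothOn (fun z => s z + t z) V := by
  intro e he i
  have : (fun x => F.coeff e x (s x + t x) i) =
      fun x => F.coeff e x (s x) i + F.coeff e x (t x) i := by
    funext x; simp
  rw [this]
  exact ContMDiffOn.add (hs e he i) (ht e he i)

theorem isSmoothOn_sum {V : Set M} {ι : Type*} (S : Finset ι) {s : ι → ∀ x, F.Normal x}
    (hs : ∀ i, F.IsSmoothOn (s i) V) : F.IsSmoothOn (fun z => ∑ i ∈ S, s i z) V := by
  classical
  induction S using Finset.induction_on with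
  | empty => simpa using isSmoothOn_zero V
  | insert a S ha ih => simpa only [Finset.sum_insert ha] using isSmoothOn_add (hs a) ih

theorem toFun_sum {V : Set M} (hV : IsOpen V) {ι : Type*} (S : Finset ι)
    {s : ι → ∀ x, F.Normal x} (hs : ∀ i, F.IsSmoothOn (s i) V) (hx : x ∈ V)
    (v : TangentSpace (folI p q) x) :
    D.toFun (fun z => ∑ i ∈ S, s i z) x v = ∑ i ∈ S, D.toFun (s i) x v := by
  classical
  induction S using Finset.induction_on with
  | empty => simpa using D.toFun_zero v
  | insert a S ha ih =>
    simp only [Finset.sum_insert ha]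
    rw [D.add' hV (hs a) (isSmoothOn_sum S hs) x hx, LinearMap.add_apply, ih]

/-- The covariant derivative of a section in terms of its components in an adapted chart. -/
theorem toFun_eq (he : F.IsAdapted e) {V : Set M} (hV : IsOpen V) {s : ∀ x, F.Normal x}
    (hs : F.IsSmoothOn s V) (hxV : x ∈ V) (hx : x ∈ e.source) (v : TangentSpace (folI p q) x) :
    D.toFun s x v = D.toFun (F.constSection e (F.coeff e x (s x))) x v +
      F.constSection e
        (fderiv ℝ (F.coeffIn e s) (e x) (mfderiv (folI p q) (folI p q) e x v)) x := by
  have hO := hV.inter e.open_source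
  have hxO : x ∈ V ∩ e.source := ⟨hxV, hx⟩
  have hsO := hs.mono (Set.inter_subset_left : V ∩ e.source ⊆ V)
  have hc : ∀ i, SmoothFunOn (p := p) (q := q) (fun z => F.coeff e z (s z) i) (V ∩ e.source) :=
    fun i => hs e he i
  have hd : ∀ i, F.IsSmoothOn (F.coordSection e i) (V ∩ e.source) := fun i =>
    (isSmoothOn_constSection he _).mono Set.inter_subset_right
  have h1 := D.congr' hO hsO (t := fun z => ∑ i, F.coeff e z (s z) i • F.coordSection e i z)
    (fun z hz => eq_sum_coordSection he hz.2 (s z)) x hxO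
  rw [h1, D.toFun_sum hO Finset.univ (s := fun i z => F.coeff e z (s z) i • F.coordSection e i z)
    (fun i => isSmoothOn_smul (hc i) (hd i)) hxO, D.toFun_constSection_eq_sum he hx,
    constSection_eq_sum, ← Finset.sum_add_distrib]
  refine Finset.sum_congr rfl fun i _ => ?_
  rw [D.leibniz' hO (hc i) (hd i) x hxO, funDiff_coeff hV hs he hxV hx]

/-- Tensoriality: the terms that differentiate the components of `s` are the same for both
connections and cancel. -/
theorem gam_eq_constSection (he : F.IsAdapted e) {V : Set M} (hV : IsOpen V)
    {s : ∀ x, F.Normal x} (hs : F.IsSmoothOn s V) (hxV : x ∈ V) (hx : x ∈ e.source)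
    (v : TangentSpace (folI p q) x) :
    gam nabla D s x v = gam nabla D (F.constSection e (F.coeff e x (s x))) x v := by
  rw [gam, gam, nabla.toFun_eq he hV hs hxV hx, D.toFun_eq he hV hs hxV hx]
  abel

theorem toFun_bar_constField (he : F.IsAdapted e) (hx : x ∈ e.source) (c : FolModel p q) :
    D.toFun (fun z => F.bar z (constField e c z)) x = D.toFun (F.constSection e c.2) x :=
  (D.congr' e.open_source (isSmoothOn_constSection he c.2)
    (fun z hz => (bar_constField he hz c).symm) x hx).symm

variable {D nabla}

/-- The coordinate fields commute, so vanishing torsion is symmetry of the Christoffel symbols. The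
directions may have leaf components, although the sections see only the transverse ones. -/
theorem IsTorsionFree.toFun_symm (hD : D.IsTorsionFree) (he : F.IsAdapted e) (hx : x ∈ e.source)
    (c c' : FolModel p q) :
    D.toFun (F.constSection e c'.2) x (constField e c x) =
      D.toFun (F.constSection e c.2) x (constField e c' x) := by
  have h := hD e.source (constField e c) (constField e c') e.open_source
    (smoothFieldOn_constField he.1 c) (smoothFieldOn_constField he.1 c') x hx
  rw [mlieBracket_constField he.1 hx, map_zero, toFun_bar_constField D he hx,
    toFun_bar_constField D he hx] at h
  exact sub_eq_zero.1 h

theorem gam_symm (hD : D.IsTorsionFree) (hn : nabla.IsTorsionFree) (he : F.IsAdapted e)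
    (hx : x ∈ e.source) (c c' : FolModel p q) :
    gam nabla D (F.constSection e c'.2) x (constField e c x) =
      gam nabla D (F.constSection e c.2) x (constField e c' x) := by
  rw [gam, gam, hD.toFun_symm he hx, hn.toFun_symm he hx]

/-- The difference of two torsion-free connections is a symmetric tensor on the normal bundle. -/
theorem exists_gam_tensor (hD : D.IsTorsionFree) (hn : nabla.IsTorsionFree) (x : M) :
    ∃ B : F.Normal x →ₗ[ℝ] F.Normal x →ₗ[ℝ] F.Normal x,
      (∀ (V : Set M) (s : ∀ x, F.Normal x), IsOpen V → F.IsSmoothOn s V → x ∈ V →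
        ∀ u, gam nabla D s x u = B (F.bar x u) (s x)) ∧ ∀ a b, B a b = B b a := by
  obtain ⟨e, hx, he⟩ := F.exists_adapted x
  replace he : F.IsAdapted e := he
  -- Both arguments are extended with constant components in `e`, and the direction is lifted with
  -- zero leaf component; the lift is shown below to be immaterial.
  let B : F.Normal x →ₗ[ℝ] F.Normal x →ₗ[ℝ] F.Normal x := LinearMap.mk₂ ℝ
    (fun a b => gam nabla D (F.constSection e (F.coeff e x b)) x
      (constField e (0, F.coeff e x a) x))
    (fun a a' b => by
      have : ((0, F.coeff e x (a + a')) : FolModel p q) =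
        (0, F.coeff e x a) + (0, F.coeff e x a') := by simp
      simp only [gam]
      rw [this, constField_add]
      simp only [map_add]
      abel)
    (fun t a b => by
      have : ((0, F.coeff e x (t • a)) : FolModel p q) = t • (0, F.coeff e x a) := by simp
      simp only [gam]
      rw [this, constField_smul]
      simp only [map_smul, smul_sub])
    (fun a b b' => by
      simp only [gam, map_add, toFun_constSection_add _ he hx]
      abel)
    (fun t a b => by
      simp only [gam, map_smul, toFun_constSection_smul _ he hx, smul_sub])
  have hB : ∀ a b, B a b = gam nabla D (F.constSection e (F.coeff e x b)) x
      (constField e (0, F.coeff e x a) x) := fun _ _ => rfl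
  refine ⟨B, fun V s hV hs hxV u => ?_, fun a b => ?_⟩
  · rw [gam_eq_constSection D nabla he hV hs hxV hx, hB, coeff_bar he hx]
    set c : FolModel p q := mfderiv (folI p q) (folI p q) e x u with hc
    have hu : u = constField e c x := (constField_mfderiv he.1 hx u).symm
    rw [hu]
    -- The symmetry is used twice: turning the direction `c` into a section forgets its leaf
    -- component, and turning it back gives the direction `(0, c.2)`. So `γ_u` depends only on the
    -- class of `u`.
    have h1 := gam_symm hD hn he hx c (0, F.coeff e x (s x))
    have h2 := gam_symm hD hn he hx (0, c.2) (0, F.coeff e x (s x))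
    exact h1.trans h2.symm
  · rw [hB, hB]
    exact gam_symm hD hn he hx (0, F.coeff e x a) (0, F.coeff e x b)

end NormalConnection

theorem linearMap_ext_coordSection (he : F.IsAdapted e) (hx : x ∈ e.source) {W : Type*}
    [AddCommGroup W] [Module ℝ W] {f g : F.Normal x →ₗ[ℝ] W}
    (h : ∀ i, f (F.coordSection e i x) = g (F.coordSection e i x)) (n : F.Normal x) :
    f n = g n := by
  rw [eq_sum_coordSection he hx n]
  simp only [map_sum, map_smul, h]

/-! ### Reduction of the conditions to a pointwise symmetry -/

namespace NormalConnection

variable {D nabla : F.NormalConnection} {g : F.NormalMetric}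

/-- `B` is the tensor `γ = ∇ - D`, and it is symmetric. -/
def IsGamTensor (nabla D : F.NormalConnection)
    (B : ∀ x, F.Normal x →ₗ[ℝ] F.Normal x →ₗ[ℝ] F.Normal x) : Prop :=
  ∀ x, (∀ (V : Set M) (s : ∀ x, F.Normal x), IsOpen V → F.IsSmoothOn s V → x ∈ V →
      ∀ u, gam nabla D s x u = B x (F.bar x u) (s x)) ∧ ∀ a b, B x a b = B x b a

/-- The pointwise symmetry of `g(γ_b c, a)` under the exchange of `a` and `b`. -/
def CodazziAt (g : F.NormalMetric) (B : ∀ x, F.Normal x →ₗ[ℝ] F.Normal x →ₗ[ℝ] F.Normal x)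
    (x : M) : Prop :=
  ∀ a b c, g.toFun x a (B x b c) = g.toFun x b (B x a c)

variable {B : ∀ x, F.Normal x →ₗ[ℝ] F.Normal x →ₗ[ℝ] F.Normal x}

/-- Both sides are trilinear, so the identity extends from the basis `∂_i` one argument at a time.
-/
theorem codazziAt_of_coordSection (he : F.IsAdapted e) (hx : x ∈ e.source)
    (h : ∀ i j k, g.toFun x (F.coordSection e i x)
        (B x (F.coordSection e j x) (F.coordSection e k x)) =
      g.toFun x (F.coordSection e j x) (B x (F.coordSection e i x) (F.coordSection e k x))) :
    CodazziAt g B x := by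
  intro a b c
  refine linearMap_ext_coordSection he hx (f := g.toFun x a ∘ₗ B x b)
    (g := g.toFun x b ∘ₗ B x a) (fun k => ?_) c
  refine linearMap_ext_coordSection he hx (f := g.toFun x a ∘ₗ (B x).flip (F.coordSection e k x))
    (g := (g.toFun x).flip (B x a (F.coordSection e k x))) (fun j => ?_) b
  exact linearMap_ext_coordSection he hx
    (f := (g.toFun x).flip (B x (F.coordSection e j x) (F.coordSection e k x)))
    (g := g.toFun x (F.coordSection e j x) ∘ₗ (B x).flip (F.coordSection e k x))
    (fun i => h i j k) a

/-- Subtracting `∇g = 0` cancels the derivative of `g(Y, Z)` and leaves only the difference tensor.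
-/
theorem covDerivMetric_eq (hn : nabla.IsLeviCivita g) (hB : IsGamTensor nabla D B) {V : Set M}
    (hV : IsOpen V) {Y Z : ∀ x, F.Normal x} (hY : F.IsSmoothOn Y V) (hZ : F.IsSmoothOn Z V)
    (hx : x ∈ V) (v : TangentSpace (folI p q) x) :
    D.covDerivMetric g Y Z x v = g.toFun x (B x (F.bar x v) (Y x)) (Z x) +
      g.toFun x (Y x) (B x (F.bar x v) (Z x)) := by
  have h := hn.2 V Y Z hV hY hZ x hx v
  rw [← (hB x).1 V Y hV hY hx, ← (hB x).1 V Z hV hZ hx, gam, gam]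
  rw [covDerivMetric] at h ⊢
  simp only [map_sub, LinearMap.sub_apply]
  linarith

theorem codazzi_iff_of_symm (hB : IsGamTensor nabla D B) (a b c : F.Normal x) :
    g.toFun x (B x a b) c + g.toFun x b (B x a c) = g.toFun x (B x b a) c + g.toFun x a (B x b c) ↔
      g.toFun x a (B x b c) = g.toFun x b (B x a c) := by
  rw [(hB x).2 b a]
  constructor <;> intro h <;> linarith

/-- Any three normal vectors at a point extend to foliated sections with constant components in an
adapted chart, so the equation for sections is equivalent to its pointwise form. -/
theorem codazziOn_iff (hn : nabla.IsLeviCivita g) (hB : IsGamTensor nabla D B) {W : Set M}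
    (hW : IsOpen W) : D.CodazziOn g W ↔ ∀ x ∈ W, CodazziAt g B x := by
  constructor
  · intro h x hx a b c
    obtain ⟨e, hxe, he⟩ := F.exists_adapted x
    replace he : F.IsAdapted e := he
    have hO := hW.inter e.open_source
    have hs : ∀ n, F.IsFoliatedOn (F.constSection e (F.coeff e x n)) (W ∩ e.source) := fun n =>
      (isFoliatedOn_constSection he _).mono Set.inter_subset_right
    obtain ⟨u, hu⟩ := bar_surjective a
    obtain ⟨v, hv⟩ := bar_surjective b
    have key := h _ _ _ _ hO Set.inter_subset_left (hs a) (hs b) (hs c) x ⟨hx, hxe⟩ u v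
      (by rw [hu, constSection_coeff he hxe]) (by rw [hv, constSection_coeff he hxe])
    rw [covDerivMetric_eq hn hB hO (hs b).isSmoothOn (hs c).isSmoothOn ⟨hx, hxe⟩,
      covDerivMetric_eq hn hB hO (hs a).isSmoothOn (hs c).isSmoothOn ⟨hx, hxe⟩, hu, hv] at key
    simp only [constSection_coeff he hxe] at key
    exact (codazzi_iff_of_symm hB a b c).1 key
  · intro h V X Y Z hV hVW hX hY hZ x hx u v hu hv
    rw [covDerivMetric_eq hn hB hV hY.isSmoothOn hZ.isSmoothOn hx,
      covDerivMetric_eq hn hB hV hX.isSmoothOn hZ.isSmoothOn hx, hu, hv]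
    exact (codazzi_iff_of_symm hB _ _ _).2 (h x (hVW hx) _ _ _)

/-- By symmetry of `γ`, the operator index can be exchanged with the argument: `g(γ_c b, a) = g(b,
γ_c a)` becomes `g(γ_b c, a) = g(b, γ_a c)`. -/
theorem gamSelfAdjointOn_iff (hB : IsGamTensor nabla D B) {W : Set M}
    (hW : IsOpen W) : nabla.GamSelfAdjointOn D g W ↔ ∀ x ∈ W, CodazziAt g B x := by
  constructor
  · intro h x hx a b c
    obtain ⟨e, hxe, he⟩ := F.exists_adapted x
    replace he : F.IsAdapted e := he
    have hO := hW.inter e.open_source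
    have hs : ∀ n, F.IsFoliatedOn (F.constSection e (F.coeff e x n)) (W ∩ e.source) := fun n =>
      (isFoliatedOn_constSection he _).mono Set.inter_subset_right
    obtain ⟨u, hu⟩ := bar_surjective c
    have key := h _ _ _ _ hO Set.inter_subset_left (hs c) (hs b) (hs a) x ⟨hx, hxe⟩ u
      (by rw [hu, constSection_coeff he hxe])
    rw [(hB x).1 _ _ hO (hs b).isSmoothOn ⟨hx, hxe⟩, (hB x).1 _ _ hO (hs a).isSmoothOn ⟨hx, hxe⟩,
      hu] at key
    simp only [constSection_coeff he hxe] at key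
    rw [(hB x).2 b c, (hB x).2 a c, g.symm', key]
  · intro h V X Y Z hV hVW hX hY hZ x hx u hu
    rw [(hB x).1 _ _ hV hY.isSmoothOn hx, (hB x).1 _ _ hV hZ.isSmoothOn hx, hu, g.symm',
      (hB x).2 (X x), (hB x).2 (X x)]
    exact h x (hVW hx) _ _ _

theorem gamLower_eq (hB : IsGamTensor nabla D B) (he : F.IsAdapted e) (hx : x ∈ e.source)
    (i j k : Fin q) : gamLower nabla D g e i j k x = g.toFun x (F.coordSection e i x)
      (B x (F.coordSection e j x) (F.coordSection e k x)) := by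
  have h : gam nabla D (F.coordSection e k) x (coordVec e j x) =
      B x (F.coordSection e j x) (F.coordSection e k x) :=
    (hB x).1 e.source _ e.open_source (isSmoothOn_constSection he _) hx _
  rw [eq_sum_coordSection he hx (B x (F.coordSection e j x) (F.coordSection e k x)), ← h]
  simp only [gamLower, gamUpper, NormalMetric.comp, map_sum, map_smul, smul_eq_mul, mul_comm]

theorem gamLowerSymm_iff (hB : IsGamTensor nabla D B) (he : F.IsAdapted e) :
    nabla.GamLowerSymm D g e ↔ ∀ x ∈ e.source, CodazziAt g B x := by
  constructor
  · intro h x hx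
    refine codazziAt_of_coordSection he hx fun i j k => ?_
    have := h x hx i j k
    rwa [gamLower_eq hB he hx, gamLower_eq hB he hx] at this
  · intro h x hx i j k
    rw [gamLower_eq hB he hx, gamLower_eq hB he hx]
    exact h x hx _ _ _

theorem contMDiffAt_comp (he : F.IsAdapted e) (hx : x ∈ e.source) (i j : Fin q) :
    ContMDiffAt (folI p q) 𝓘(ℝ, ℝ) ∞ (g.comp e i j) x :=
  (smoothFunOn_iff e.open_source).1 (g.smooth' e.open_source (isSmoothOn_constSection he _)
    (isSmoothOn_constSection he _)) x hx

/-- In an affine chart the `∂_i` are parallel, so the partial derivatives of `g_ij` are exactly the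
components of `Dg`. -/
theorem partialY_comp_eq (hn : nabla.IsLeviCivita g) (hB : IsGamTensor nabla D B)
    (he : D.IsAffineChart e) (hx : x ∈ e.source) (i j k : Fin q) :
    partialY e (g.comp e i j) k x =
      g.toFun x (B x (F.coordSection e k x) (F.coordSection e i x)) (F.coordSection e j x) +
      g.toFun x (F.coordSection e i x) (B x (F.coordSection e k x) (F.coordSection e j x)) := by
  rw [partialY_eq_funDiff he.1.1 hx (contMDiffAt_comp he.1 hx i j)]
  have h := covDerivMetric_eq (D := D) hn hB e.open_source
    (isSmoothOn_constSection he.1 (EuclideanSpace.single i 1))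
    (isSmoothOn_constSection he.1 (EuclideanSpace.single j 1)) hx (coordVec e k x)
  simp only [← coordSection_eq_constSection] at h
  rw [covDerivMetric, he.2 x hx, he.2 x hx] at h
  simp only [map_zero, LinearMap.zero_apply, sub_zero] at h
  exact h

theorem derivSymm_at_iff (hn : nabla.IsLeviCivita g) (hB : IsGamTensor nabla D B)
    (he : D.IsAffineChart e) (hx : x ∈ e.source) :
    (∀ i j k, partialY e (g.comp e i j) k x = partialY e (g.comp e k j) i x) ↔
      CodazziAt g B x := by
  have h : ∀ i j k, partialY e (g.comp e i j) k x = partialY e (g.comp e k j) i x ↔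
      g.toFun x (F.coordSection e k x) (B x (F.coordSection e i x) (F.coordSection e j x)) =
      g.toFun x (F.coordSection e i x) (B x (F.coordSection e k x) (F.coordSection e j x)) := by
    intro i j k
    rw [partialY_comp_eq hn hB he hx, partialY_comp_eq hn hB he hx]
    exact codazzi_iff_of_symm hB _ _ _
  simp only [h]
  exact ⟨fun h => codazziAt_of_coordSection he.1 hx fun i j k => h j k i, fun h i j k => h _ _ _⟩

theorem derivSymm_iff (hn : nabla.IsLeviCivita g) (hB : IsGamTensor nabla D B)
    (he : D.IsAffineChart e) :
    DerivSymm g e ↔ ∀ x ∈ e.source, CodazziAt g B x :=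
  forall₂_congr fun x hx => derivSymm_at_iff hn hB he hx

end NormalConnection

/-! ### Charts onto balls and functions of the transverse coordinates -/

theorem IsAdapted.restrOpen (he : F.IsAdapted e) {S : Set M} (hS : IsOpen S) :
    F.IsAdapted (e.restrOpen S hS) := by
  refine ⟨?_, fun x hx => he.2 x hx.1⟩
  refine OpenPartialHomeomorph.mem_maximalAtlas_of_contMDiffOn _
    ((contMDiffOn_of_mem_maximalAtlas he.1).mono fun z hz => hz.1)
    ((contMDiffOn_symm_of_mem_maximalAtlas he.1).mono fun z hz => ?_)
  exact hz.1

theorem NormalConnection.IsAffineChart.restrOpen {D : F.NormalConnection} (he : D.IsAffineChart e)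
    {S : Set M} (hS : IsOpen S) : D.IsAffineChart (e.restrOpen S hS) :=
  ⟨he.1.restrOpen hS, fun x hx i v => he.2 x hx.1 i v⟩

/-- Every chart restricts to a chart with small domain and with a ball as its range. -/
theorem exists_restrOpen_target_eq_ball (e : OpenPartialHomeomorph M (FolModel p q))
    (hx : x ∈ e.source) {W : Set M} (hW : IsOpen W) (hxW : x ∈ W) :
    ∃ (S : Set M) (hS : IsOpen S), x ∈ (e.restrOpen S hS).source ∧
      (e.restrOpen S hS).source ⊆ W ∧ ∃ r > 0, (e.restrOpen S hS).target = Metric.ball (e x) r := by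
  have ho : IsOpen (e.target ∩ e.symm ⁻¹' W) := e.isOpen_inter_preimage_symm hW
  obtain ⟨r, hr, hrs⟩ := Metric.isOpen_iff.1 ho (e x)
    ⟨e.map_source hx, by rwa [Set.mem_preimage, e.left_inv hx]⟩
  have hS := e.isOpen_inter_preimage (Metric.isOpen_ball (x := e x) (ε := r))
  refine ⟨_, hS, ⟨hx, hx, Metric.mem_ball_self hr⟩, ?_, r, hr, ?_⟩
  · rintro z ⟨hz, -, hz'⟩
    have := (hrs hz').2
    rwa [Set.mem_preimage, e.left_inv hz] at this
  · ext w
    constructor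
    · rintro ⟨hw, -, hw'⟩
      have h : e (e.symm w) ∈ Metric.ball (e x) r := hw'
      have hw0 : w ∈ e.target := hw
      rwa [e.right_inv hw0] at h
    · intro hw
      have hwt := (hrs hw).1
      refine ⟨hwt, e.map_target hwt, ?_⟩
      change e (e.symm w) ∈ Metric.ball (e x) r
      rwa [e.right_inv hwt]

/-- The model carries the maximum norm, so a ball is a product of balls: its plaques are connected
and its transversal is convex. -/
theorem mem_ball_iff_prod {c w : FolModel p q} {r : ℝ} :
    w ∈ Metric.ball c r ↔ w.1 ∈ Metric.ball c.1 r ∧ w.2 ∈ Metric.ball c.2 r := by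
  rw [← Set.mem_prod, ball_prod_same]

theorem mem_ball_transversal {c : FolModel p q} {r : ℝ} {y : EuclideanSpace ℝ (Fin q)}
    (hy : y ∈ Metric.ball c.2 r) : ((c.1, y) : FolModel p q) ∈ Metric.ball c r :=
  mem_ball_iff_prod.2 ⟨Metric.mem_ball_self (Metric.pos_of_mem_ball hy), hy⟩

/-- In an adapted chart whose range is a ball, a basic function depends only on the transverse
coordinates. -/
theorem basic_eq_transversal (he : F.IsAdapted e) {c : FolModel p q} {r : ℝ}
    (ht : e.target = Metric.ball c r) {f : M → ℝ} (hf : ∀ z ∈ e.source, F.BasicAt f z)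
    {w : FolModel p q} (hw : w ∈ Metric.ball c r) :
    f (e.symm w) = f (e.symm (c.1, w.2)) := by
  have hw' := mem_ball_iff_prod.1 hw
  have hder : ∀ a ∈ Metric.ball c.1 r,
      HasFDerivAt (fun a => f (e.symm (a, w.2))) (0 : EuclideanSpace ℝ (Fin p) →L[ℝ] ℝ) a := by
    intro a ha
    have haw : ((a, w.2) : FolModel p q) ∈ e.target := by
      rw [ht]; exact mem_ball_iff_prod.2 ⟨ha, hw'.2⟩
    have hb := (basicAt_iff_chart he (e.map_target haw)).1 (hf _ (e.map_target haw))
    rw [e.right_inv haw] at hb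
    refine (HasFDerivAt.comp (g := fun w => f (e.symm w)) (f := fun a => (a, w.2)) a
      (hb.1.differentiableAt (by simp)).hasFDerivAt
      (hasFDerivAt_prodMk_left a w.2)).congr_fderiv ?_
    ext v
    exact hb.2 v
  exact Metric.isOpen_ball.is_const_of_fderiv_eq_zero (convex_ball c.1 r).isPreconnected
    (fun a ha => (hder a ha).differentiableAt.differentiableWithinAt)
    (fun a ha => (hder a ha).fderiv) hw'.1
    (Metric.mem_ball_self (Metric.pos_of_mem_ball hw))

theorem coeffIn_eq_transversal (he : F.IsAdapted e) {c : FolModel p q} {r : ℝ}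
    (ht : e.target = Metric.ball c r) {s : ∀ x, F.Normal x} (hs : F.IsFoliatedOn s e.source)
    {w : FolModel p q} (hw : w ∈ Metric.ball c r) :
    F.coeffIn e s w = F.coeffIn e s (c.1, w.2) := by
  ext i
  exact basic_eq_transversal he ht (f := fun z => F.coeff e z (s z) i)
    (fun z hz => hs.basicAt e.open_source he hz hz i) hw

theorem comp_symm_eventuallyEq {G : Type*} {f : M → G} {ψ : EuclideanSpace ℝ (Fin q) → G}
    (h : ∀ z ∈ e.source, f z = ψ (e z).2) (hx : x ∈ e.source) :
    (fun w => f (e.symm w)) =ᶠ[𝓝 (e x)] fun w => ψ w.2 := by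
  filter_upwards [e.open_target.mem_nhds (e.map_source hx)] with w hw
  rw [h _ (e.map_target hw), e.right_inv hw]

theorem partialY_of_transversal {f : M → ℝ} {ψ : EuclideanSpace ℝ (Fin q) → ℝ}
    (h : ∀ z ∈ e.source, f z = ψ (e z).2) (hx : x ∈ e.source)
    {ψ' : EuclideanSpace ℝ (Fin q) →L[ℝ] ℝ} (hψ : HasFDerivAt ψ ψ' (e x).2) (i : Fin q) :
    partialY e f i x = ψ' (EuclideanSpace.single i 1) := by
  rw [partialY, (comp_symm_eventuallyEq h hx).fderiv_eq]
  have h1 : HasFDerivAt (fun w : FolModel p q => ψ w.2)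
      (ψ'.comp (ContinuousLinearMap.snd ℝ _ _)) (e x) := hψ.comp (e x) hasFDerivAt_snd
  rw [h1.fderiv]
  rfl

theorem basicAt_of_transversal (he : F.IsAdapted e) {f : M → ℝ}
    {ψ : EuclideanSpace ℝ (Fin q) → ℝ} (h : ∀ z ∈ e.source, f z = ψ (e z).2) (hx : x ∈ e.source)
    (hψ : ContDiffAt ℝ ∞ ψ (e x).2) : F.BasicAt f x := by
  rw [basicAt_iff_chart he hx]
  have heq := comp_symm_eventuallyEq h hx
  refine ⟨(hψ.comp (e x) contDiffAt_snd).congr_of_eventuallyEq heq, fun a => ?_⟩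
  have h1 : HasFDerivAt (fun w : FolModel p q => ψ w.2) _ (e x) :=
    (hψ.differentiableAt (by simp)).hasFDerivAt.comp (e x) hasFDerivAt_snd
  rw [heq.fderiv_eq, h1.fderiv]
  simp

/-! ### Hessian potentials -/

namespace NormalConnection

variable {D nabla : F.NormalConnection} {g : F.NormalMetric}
  {B : ∀ x, F.Normal x →ₗ[ℝ] F.Normal x →ₗ[ℝ] F.Normal x}

/-- Both sides are third derivatives of `h`; they differ by the order of `∂_i` and `∂_k` acting on
`∂_j h`. -/
theorem partialY_hessian_comm (he : F.IsAdapted e) {h : M → ℝ} (hh : F.IsBasicOn h e.source)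
    (hg : ∀ z ∈ e.source, ∀ i j, g.comp e i j z = partialY e (partialY e h j) i z)
    (hx : x ∈ e.source) (i j k : Fin q) :
    partialY e (g.comp e i j) k x = partialY e (g.comp e k j) i x := by
  set H := fun w => h (e.symm w) with hH
  set K := fun w => fderiv ℝ H w (0, EuclideanSpace.single j 1) with hK
  have hHs : ContDiffAt ℝ ∞ H (e x) :=
    ((basicAt_iff_chart he hx).1 ((isBasicOn_iff e.open_source).1 hh x hx)).1
  have hKs : ContDiffAt ℝ ∞ K (e x) :=
    (hHs.fderiv_right (m := ∞) (by simp)).clm_apply contDiffAt_const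
  have hKe : ∀ w ∈ e.target, (fun w => partialY e h j (e.symm w)) =ᶠ[𝓝 w] K := by
    intro w hw
    filter_upwards [e.open_target.mem_nhds hw] with w' hw'
    rw [partialY, e.right_inv hw']
  have hge : ∀ l, (fun w => g.comp e l j (e.symm w)) =ᶠ[𝓝 (e x)]
      fun w => fderiv ℝ K w (0, EuclideanSpace.single l 1) := by
    intro l
    filter_upwards [e.open_target.mem_nhds (e.map_source hx)] with w hw
    rw [hg _ (e.map_target hw), partialY, e.right_inv hw, (hKe w hw).fderiv_eq]
  rw [partialY, partialY, (hge i).fderiv_eq, (hge k).fderiv_eq, fderiv_fderiv_apply_comm hKs]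

theorem codazziAt_of_hessianOn (hn : nabla.IsLeviCivita g) (hB : IsGamTensor nabla D B) {W : Set M}
    (h : D.HessianOn g W) (hx : x ∈ W) : CodazziAt g B x := by
  obtain ⟨e, he, hxe, f, hf, hg⟩ := h x hx
  exact (derivSymm_at_iff hn hB he hxe).1 fun i j k => partialY_hessian_comm he.1 hf hg hxe i j k

theorem IsAffineChart.toFun_constSection (he : D.IsAffineChart e) (hx : x ∈ e.source)
    (w : EuclideanSpace ℝ (Fin q)) (v : TangentSpace (folI p q) x) :
    D.toFun (F.constSection e w) x v = 0 := by
  rw [D.toFun_constSection_eq_sum he.1 hx]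
  exact Finset.sum_eq_zero fun i _ => by rw [he.2 x hx, smul_zero]

/-- In an affine chart, the derivative of the metric components satisfies the Codazzi symmetry. -/
theorem funDiff_metric_comm (hn : nabla.IsLeviCivita g) (hB : IsGamTensor nabla D B)
    (he : D.IsAffineChart e) (hx : x ∈ e.source) (hc : CodazziAt g B x)
    (a b c : EuclideanSpace ℝ (Fin q)) :
    funDiff (p := p) (q := q)
        (fun z => g.toFun z (F.constSection e b z) (F.constSection e c z)) x
        (constField e (0, a) x) =
      funDiff (p := p) (q := q)
        (fun z => g.toFun z (F.constSection e a z) (F.constSection e c z)) x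
        (constField e (0, b) x) := by
  have key : ∀ a b, funDiff (p := p) (q := q)
        (fun z => g.toFun z (F.constSection e b z) (F.constSection e c z)) x
        (constField e (0, a) x) =
      g.toFun x (B x (F.constSection e a x) (F.constSection e b x)) (F.constSection e c x) +
      g.toFun x (F.constSection e b x) (B x (F.constSection e a x) (F.constSection e c x)) := by
    intro a b
    have h := covDerivMetric_eq (D := D) hn hB e.open_source (isSmoothOn_constSection he.1 b)
      (isSmoothOn_constSection he.1 c) hx (constField e (0, a) x)
    rw [covDerivMetric, he.toFun_constSection hx, he.toFun_constSection hx] at h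
    simp only [map_zero, LinearMap.zero_apply, sub_zero] at h
    exact h
  rw [key, key]
  exact (codazzi_iff_of_symm hB _ _ _).2 (hc _ _ _)

/-- The Codazzi symmetry in an affine chart whose range is a ball yields a potential. -/
theorem exists_potential (hg : g.IsFoliated) (hn : nabla.IsLeviCivita g)
    (hB : IsGamTensor nabla D B) (he : D.IsAffineChart e) {c : FolModel p q} {r : ℝ}
    (ht : e.target = Metric.ball c r) (hc : ∀ x ∈ e.source, CodazziAt g B x) :
    ∃ h : M → ℝ, F.IsBasicOn h e.source ∧
      ∀ z ∈ e.source, ∀ i j : Fin q, g.comp e i j z = partialY e (partialY e h j) i z := by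
  -- The metric is read off along the transversal through the centre; being foliated, it has these
  -- same components on the whole chart.
  let Γ : EuclideanSpace ℝ (Fin q) → EuclideanSpace ℝ (Fin q) →L[ℝ]
      EuclideanSpace ℝ (Fin q) →L[ℝ] ℝ := fun y =>
    LinearMap.toContinuousBilinearMap
      ((g.toFun (e.symm (c.1, y))).compl₁₂ (F.constSectionₗ e _) (F.constSectionₗ e _))
  have hΓ : ∀ y a b, Γ y a b = g.toFun (e.symm (c.1, y))
      (F.constSection e a (e.symm (c.1, y))) (F.constSection e b (e.symm (c.1, y))) :=
    fun _ _ _ => rfl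
  have hbasic : ∀ a b, ∀ z ∈ e.source, F.BasicAt
      (fun z => g.toFun z (F.constSection e a z) (F.constSection e b z)) z := fun a b =>
    (isBasicOn_iff e.open_source).1 (hg e.source _ _ e.open_source
      (isFoliatedOn_constSection he.1 a) (isFoliatedOn_constSection he.1 b))
  have hmet : ∀ a b, ∀ z ∈ e.source,
      g.toFun z (F.constSection e a z) (F.constSection e b z) = Γ (e z).2 a b := by
    intro a b z hz
    have hez := e.map_source hz
    rw [ht] at hez
    have := basic_eq_transversal he.1 ht (hbasic a b) hez
    rwa [e.left_inv hz] at this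
  have hmem : ∀ y ∈ Metric.ball c.2 r, ((c.1, y) : FolModel p q) ∈ e.target := fun y hy => by
    rw [ht]; exact mem_ball_transversal hy
  have hΓs : ContDiffOn ℝ ∞ Γ (Metric.ball c.2 r) := by
    refine contDiffOn_clm_apply.2 fun a => contDiffOn_clm_apply.2 fun b => ?_
    intro y hy
    have h1 := ((basicAt_iff_chart he.1 (e.map_target (hmem y hy))).1
      (hbasic a b _ (e.map_target (hmem y hy)))).1
    rw [e.right_inv (hmem y hy)] at h1
    exact (h1.comp y (contDiffAt_const.prodMk contDiffAt_id)).contDiffWithinAt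
  have hΓd : ∀ y ∈ Metric.ball c.2 r, DifferentiableAt ℝ Γ y := fun y hy =>
    (hΓs.contDiffAt (Metric.isOpen_ball.mem_nhds hy)).differentiableAt (by simp)
  have hclosed : ∀ y ∈ Metric.ball c.2 r, ∀ a b, fderiv ℝ Γ y a b = fderiv ℝ Γ y b a := by
    intro y hy a b
    ext d
    have hz := e.map_target (hmem y hy)
    have key : ∀ a b, funDiff (p := p) (q := q)
        (fun z => g.toFun z (F.constSection e b z) (F.constSection e d z)) (e.symm (c.1, y))
        (constField e (0, a) (e.symm (c.1, y))) = fderiv ℝ Γ y a b d := by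
      intro a b
      rw [funDiff_eq_fderiv_chart he.1.1 hz (hbasic b d _ hz).1, mfderiv_constField he.1.1 hz,
        (comp_symm_eventuallyEq (ψ := fun y => Γ y b d) (hmet b d) hz).fderiv_eq,
        e.right_inv (hmem y hy)]
      exact fderiv_snd_apply_apply (Γ := Γ) (w := (c.1, y)) (hΓd y hy) b d (0, a)
    rw [← key, ← key]
    exact funDiff_metric_comm hn hB he hz (hc _ hz) a b d
  -- The Poincaré lemma is applied twice. The Codazzi symmetry gives `Θ` with `dΘ = Γ`; the symmetry
  -- of `g` then makes the one-form `Θ` itself closed, with primitive `H`.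
  obtain ⟨Θ, hΘ⟩ := (convex_ball c.2 r).exists_forall_hasFDerivAt_of_fderiv_symmetric
    Metric.isOpen_ball (hΓs.differentiableOn (by simp)) hclosed
  obtain ⟨H, hH⟩ := (convex_ball c.2 r).exists_forall_hasFDerivAt_of_fderiv_symmetric
    Metric.isOpen_ball (fun y hy => (hΘ y hy).differentiableAt.differentiableWithinAt)
    (fun y hy a b => by
      rw [(hΘ y hy).fderiv, hΓ, hΓ, g.symm'])
  have hΘs : ContDiffOn ℝ ∞ Θ (Metric.ball c.2 r) :=
    contDiffOn_infty_of_hasFDerivAt Metric.isOpen_ball hΘ hΓs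
  have hHs : ContDiffOn ℝ ∞ H (Metric.ball c.2 r) :=
    contDiffOn_infty_of_hasFDerivAt Metric.isOpen_ball hH hΘs
  have hsrc : ∀ z ∈ e.source, (e z).2 ∈ Metric.ball c.2 r := fun z hz => by
    have := e.map_source hz
    rw [ht] at this
    exact (mem_ball_iff_prod.1 this).2
  refine ⟨fun z => H (e z).2, (isBasicOn_iff e.open_source).2 fun z hz =>
    basicAt_of_transversal he.1 (fun _ _ => rfl) hz
      (hHs.contDiffAt (Metric.isOpen_ball.mem_nhds (hsrc z hz))), fun z hz i j => ?_⟩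
  have h1 : ∀ z ∈ e.source, partialY e (fun z => H (e z).2) j z =
      (fun y => Θ y (EuclideanSpace.single j 1)) (e z).2 := fun z hz =>
    partialY_of_transversal (fun _ _ => rfl) hz (hH _ (hsrc z hz)) j
  have h2 : HasFDerivAt (fun y => Θ y (EuclideanSpace.single j (1 : ℝ)))
      ((Γ (e z).2).flip (EuclideanSpace.single j 1)) (e z).2 := by
    have h2 : HasFDerivAt (fun y => Θ y (EuclideanSpace.single j (1 : ℝ))) _ (e z).2 :=
      (hΘ _ (hsrc z hz)).clm_apply (hasFDerivAt_const _ _)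
    rwa [ContinuousLinearMap.comp_zero, zero_add] at h2
  rw [partialY_of_transversal h1 hz h2 i]
  exact hmet _ _ z hz

theorem hessianOn_of_codazziAt (hg : g.IsFoliated) (hn : nabla.IsLeviCivita g)
    (hB : IsGamTensor nabla D B) (hD : ∀ x, ∃ e, D.IsAffineChart e ∧ x ∈ e.source) {W : Set M}
    (hW : IsOpen W) (hc : ∀ x ∈ W, CodazziAt g B x) : D.HessianOn g W := by
  intro x hx
  obtain ⟨e, he, hxe⟩ := hD x
  -- The chart is shrunk into `W`, where the symmetry is known, and to a ball, where closed forms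
  -- are exact.
  obtain ⟨S, hS, hxS, hSW, r, hr, ht⟩ := exists_restrOpen_target_eq_ball e hxe hW hx
  exact ⟨_, he.restrOpen hS, hxS,
    exists_potential hg hn hB (he.restrOpen hS) ht fun z hz => hc z (hSW hz)⟩

end NormalConnection

/-- The chart `e` with its transverse coordinates changed by the local diffeomorphism `φ`. -/
def transChart (e : OpenPartialHomeomorph M (FolModel p q))
    (φ : OpenPartialHomeomorph (EuclideanSpace ℝ (Fin q)) (EuclideanSpace ℝ (Fin q))) :
    OpenPartialHomeomorph M (FolModel p q) :=
  e.trans ((OpenPartialHomeomorph.refl (EuclideanSpace ℝ (Fin p))).prod φ)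

/-! ### Change of the transverse coordinates -/

section TransChart

variable {φ : OpenPartialHomeomorph (EuclideanSpace ℝ (Fin q)) (EuclideanSpace ℝ (Fin q))}

theorem mem_transChart_source {z : M} :
    z ∈ (transChart e φ).source ↔ z ∈ e.source ∧ (e z).2 ∈ φ.source := by
  simp [transChart]

theorem transChart_mem_maximalAtlas (he : e ∈ IsManifold.maximalAtlas (folI p q) ∞ M)
    (hφ : ContDiffOn ℝ ∞ φ φ.source) (hφ' : ContDiffOn ℝ ∞ φ.symm φ.target) :
    transChart e φ ∈ IsManifold.maximalAtlas (folI p q) ∞ M := by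
  have h1 : ContMDiffOn (folI p q) (folI p q) ∞ (fun w : FolModel p q => (w.1, φ w.2))
      {w | w.2 ∈ φ.source} :=
    (contDiff_fst.contDiffOn.prodMk
      (hφ.comp contDiff_snd.contDiffOn fun w hw => hw)).contMDiffOn
  have h2 : ContMDiffOn (folI p q) (folI p q) ∞ (fun w : FolModel p q => (w.1, φ.symm w.2))
      {w | w.2 ∈ φ.target} :=
    (contDiff_fst.contDiffOn.prodMk
      (hφ'.comp contDiff_snd.contDiffOn fun w hw => hw)).contMDiffOn
  refine OpenPartialHomeomorph.mem_maximalAtlas_of_contMDiffOn _ ?_ ?_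
  · exact h1.comp ((contMDiffOn_of_mem_maximalAtlas he).mono fun z hz =>
      (mem_transChart_source.1 hz).1) fun z hz => (mem_transChart_source.1 hz).2
  · have ht : ∀ w ∈ (transChart e φ).target, w.2 ∈ φ.target ∧ (w.1, φ.symm w.2) ∈ e.target := by
      intro w hw
      simpa [transChart] using hw
    exact (contMDiffOn_symm_of_mem_maximalAtlas he).comp (h2.mono fun w hw => (ht w hw).1)
      fun w hw => (ht w hw).2

theorem mfderiv_transChart_snd (he : e ∈ IsManifold.maximalAtlas (folI p q) ∞ M)
    (he' : transChart e φ ∈ IsManifold.maximalAtlas (folI p q) ∞ M)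
    (hx : x ∈ (transChart e φ).source)
    {P : EuclideanSpace ℝ (Fin q) →L[ℝ] EuclideanSpace ℝ (Fin q)}
    (hP : HasFDerivAt φ P (e x).2) (v : TangentSpace (folI p q) x) :
    (mfderiv (folI p q) (folI p q) (transChart e φ) x v : FolModel p q).2 =
      P (mfderiv (folI p q) (folI p q) e x v : FolModel p q).2 := by
  have hxe := (mem_transChart_source.1 hx).1
  rw [← transDiff_apply he' hx]
  have hd : MDifferentiableAt (folI p q) 𝓘(ℝ, EuclideanSpace ℝ (Fin q))
      (fun z => (transChart e φ z).2) x := by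
    have h2 : ContMDiffAt (folI p q) 𝓘(ℝ, EuclideanSpace ℝ (Fin q)) ∞
        (Prod.snd : FolModel p q → EuclideanSpace ℝ (Fin q)) (transChart e φ x) :=
      contDiff_snd.contMDiff.contMDiffAt
    exact (h2.comp x (contMDiffAt_of_mem_maximalAtlas he' hx)).mdifferentiableAt (by simp)
  refine (mfderiv_eq_fderiv_chart he hxe hd v).trans ?_
  rw [(comp_symm_eventuallyEq (e := e) (f := fun z => (transChart e φ z).2) (ψ := φ)
    (fun z _ => rfl) hxe).fderiv_eq]
  have h1 : HasFDerivAt (fun w : FolModel p q => φ w.2) _ (e x) := hP.comp (e x) hasFDerivAt_snd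
  rw [h1.fderiv]
  rfl

end TransChart

/-! ### Christoffel symbols and existence of affine charts -/

namespace NormalConnection

variable {D : F.NormalConnection}

/-- The two directions differ by a vector tangent to the leaf, along which foliated sections are
parallel. -/
theorem IsFoliated.toFun_eq_of_snd_eq (hD : D.IsFoliated) (he : F.IsAdapted e)
    (hx : x ∈ e.source) (w : EuclideanSpace ℝ (Fin q)) (v : TangentSpace (folI p q) x) :
    D.toFun (F.constSection e w) x v = D.toFun (F.constSection e w) x
      (constField e (0, (mfderiv (folI p q) (folI p q) e x v : FolModel p q).2) x) := by
  rw [← sub_eq_zero, ← map_sub]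
  refine (hD e.source _ e.open_source (isFoliatedOn_constSection he w)).1 x hx _ ?_
  rw [he.mem_tangent_iff hx, map_sub, mfderiv_constField he.1 hx]
  exact sub_self _

/-- In an adapted chart whose range is a ball, the Christoffel symbols of a foliated connection
are functions of the transverse coordinates. -/
theorem IsFoliated.exists_christoffel (hD : D.IsFoliated) (he : F.IsAdapted e) {c : FolModel p q}
    {r : ℝ} (ht : e.target = Metric.ball c r) :
    ∃ G : EuclideanSpace ℝ (Fin q) → EuclideanSpace ℝ (Fin q) →L[ℝ] EuclideanSpace ℝ (Fin q) →L[ℝ]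
        EuclideanSpace ℝ (Fin q), ContDiffOn ℝ ∞ G (Metric.ball c.2 r) ∧
      ∀ z ∈ e.source, ∀ v b, D.toFun (F.constSection e b) z v = F.constSection e
        (G (e z).2 (mfderiv (folI p q) (folI p q) e z v : FolModel p q).2 b) z := by
  let s : EuclideanSpace ℝ (Fin q) → EuclideanSpace ℝ (Fin q) → ∀ z, F.Normal z :=
    fun a b z => D.toFun (F.constSection e b) z (constField e (0, a) z)
  have hs : ∀ a b, F.IsFoliatedOn (s a b) e.source := fun a b =>
    (hD e.source _ e.open_source (isFoliatedOn_constSection he b)).2 _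
      (isInfAutOn_constField he (0, a))
  have hex : ∀ y, ∃ L : EuclideanSpace ℝ (Fin q) →L[ℝ] EuclideanSpace ℝ (Fin q) →L[ℝ]
      EuclideanSpace ℝ (Fin q), y ∈ Metric.ball c.2 r →
        ∀ a b, L a b = F.coeffIn e (s a b) (c.1, y) := by
    intro y
    -- Bilinearity is only available over the domain of the chart; outside the ball the value 0 is a
    -- mere default.
    by_cases hy : y ∈ Metric.ball c.2 r
    · have hz : e.symm (c.1, y) ∈ e.source := e.map_target (by rw [ht]; exact mem_ball_transversal hy)
      refine ⟨LinearMap.toContinuousBilinearMap (LinearMap.mk₂ ℝ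
        (fun a b => F.coeffIn e (s a b) (c.1, y)) (fun a a' b => ?_) (fun t a b => ?_)
        (fun a b b' => ?_) (fun t a b => ?_)), fun _ a b => rfl⟩
      · have : ((0, a + a') : FolModel p q) = (0, a) + (0, a') := by simp
        simp only [coeffIn, s]
        rw [this, constField_add, map_add, map_add]
      · have : ((0, t • a) : FolModel p q) = t • (0, a) := by simp
        simp only [coeffIn, s]
        rw [this, constField_smul, map_smul, map_smul]
      · simp only [coeffIn, s]
        rw [D.toFun_constSection_add he hz, map_add]
      · simp only [coeffIn, s]
        rw [D.toFun_constSection_smul he hz, map_smul]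
    · exact ⟨0, fun h => absurd h hy⟩
  choose G hG using hex
  refine ⟨G, ?_, fun z hz v b => ?_⟩
  · refine contDiffOn_clm_apply.2 fun a => contDiffOn_clm_apply.2 fun b => ?_
    refine ContDiffOn.congr (f := fun y => F.coeffIn e (s a b) (c.1, y)) (fun y hy => ?_)
      fun y hy => hG y hy a b
    have hw : ((c.1, y) : FolModel p q) ∈ e.target := by rw [ht]; exact mem_ball_transversal hy
    have h1 := (hs a b).isSmoothOn.contDiffAt_coeffIn e.open_source he (e.map_target hw)
      (e.map_target hw)
    rw [e.right_inv hw] at h1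
    exact (h1.comp y (contDiffAt_const.prodMk contDiffAt_id)).contDiffWithinAt
  · have hw := e.map_source hz
    rw [ht] at hw
    rw [hD.toFun_eq_of_snd_eq he hz, hG _ (mem_ball_iff_prod.1 hw).2,
      ← coeffIn_eq_transversal he ht (hs _ _) hw, coeffIn, e.left_inv hz,
      constSection_coeff he hz]

section Christoffel

variable {G : EuclideanSpace ℝ (Fin q) → EuclideanSpace ℝ (Fin q) →L[ℝ]
    EuclideanSpace ℝ (Fin q) →L[ℝ] EuclideanSpace ℝ (Fin q)}

/-- `G` gives the Christoffel symbols of `D` in the chart `e`, as functions of the transverse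
coordinates. -/
def HasChristoffel (D : F.NormalConnection) (e : OpenPartialHomeomorph M (FolModel p q))
    (G : EuclideanSpace ℝ (Fin q) → EuclideanSpace ℝ (Fin q) →L[ℝ]
      EuclideanSpace ℝ (Fin q) →L[ℝ] EuclideanSpace ℝ (Fin q)) : Prop :=
  ∀ z ∈ e.source, ∀ v b, D.toFun (F.constSection e b) z v = F.constSection e
    (G (e z).2 (mfderiv (folI p q) (folI p q) e z v : FolModel p q).2 b) z

theorem HasChristoffel.coeff_eq (hG : D.HasChristoffel e G) (he : F.IsAdapted e)
    (hx : x ∈ e.source) (a b : EuclideanSpace ℝ (Fin q)) :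
    F.coeff e x (D.toFun (F.constSection e b) x (constField e (0, a) x)) = G (e x).2 a b := by
  rw [hG x hx, coeff_constSection he hx, mfderiv_constField he.1 hx]

/-- The components of a covariant derivative, in terms of the Christoffel symbols. -/
theorem HasChristoffel.coeff_toFun (hG : D.HasChristoffel e G) (he : F.IsAdapted e) {V : Set M}
    (hV : IsOpen V) {s : ∀ x, F.Normal x} (hs : F.IsSmoothOn s V) (hxV : x ∈ V)
    (hx : x ∈ e.source) (v : TangentSpace (folI p q) x) :
    F.coeff e x (D.toFun s x v) =
      G (e x).2 (mfderiv (folI p q) (folI p q) e x v : FolModel p q).2 (F.coeff e x (s x)) +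
        fderiv ℝ (F.coeffIn e s) (e x) (mfderiv (folI p q) (folI p q) e x v) := by
  rw [D.toFun_eq he hV hs hxV hx, map_add, hG x hx, coeff_constSection he hx,
    coeff_constSection he hx]

theorem HasChristoffel.symm (hG : D.HasChristoffel e G) (hD : D.IsTorsionFree)
    (he : F.IsAdapted e) (hx : x ∈ e.source) (a b : EuclideanSpace ℝ (Fin q)) :
    G (e x).2 a b = G (e x).2 b a := by
  have h2 := congrArg (F.coeff e x) (hD.toFun_symm he hx (0, a) (0, b))
  rwa [hG.coeff_eq he hx, hG.coeff_eq he hx] at h2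

theorem HasChristoffel.coeff_toFun_toFun (hG : D.HasChristoffel e G) (he : F.IsAdapted e)
    (hx : x ∈ e.source) (hGd : DifferentiableAt ℝ G (e x).2) (a b f : EuclideanSpace ℝ (Fin q)) :
    F.coeff e x (D.toFun (fun z => D.toFun (F.constSection e f) z (constField e (0, b) z)) x
        (constField e (0, a) x)) =
      G (e x).2 a (G (e x).2 b f) + fderiv ℝ G (e x).2 a b f := by
  have hss := D.smooth' e.open_source (smoothFieldOn_constField he.1 (0, b))
    (isSmoothOn_constSection he f)
  have hev : F.coeffIn e (fun z => D.toFun (F.constSection e f) z (constField e (0, b) z))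
      =ᶠ[𝓝 (e x)] fun w => G w.2 b f :=
    comp_symm_eventuallyEq (f := fun z => F.coeff e z (D.toFun (F.constSection e f) z
      (constField e (0, b) z))) (ψ := fun y => G y b f) (fun z hz => hG.coeff_eq he hz b f) hx
  rw [hG.coeff_toFun he e.open_source hss hx hx, hG.coeff_eq he hx, mfderiv_constField he.1 hx,
    hev.fderiv_eq, fderiv_snd_apply_apply (Γ := G) hGd]

/-- For commuting coordinate fields the bracket term of the curvature disappears; what remains is
the flatness condition under which `dP = P ∘ G` is integrable. -/
theorem HasChristoffel.curvature (hG : D.HasChristoffel e G) (hD : D.IsCurvatureFree)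
    (he : F.IsAdapted e) (hx : x ∈ e.source) (hGd : DifferentiableAt ℝ G (e x).2)
    (a b f : EuclideanSpace ℝ (Fin q)) :
    fderiv ℝ G (e x).2 a b f + G (e x).2 a (G (e x).2 b f) =
      fderiv ℝ G (e x).2 b a f + G (e x).2 b (G (e x).2 a f) := by
  have h := hD e.source (constField e (0, a)) (constField e (0, b)) (F.constSection e f)
    e.open_source (smoothFieldOn_constField he.1 _) (smoothFieldOn_constField he.1 _)
    (isSmoothOn_constSection he f) x hx
  rw [mlieBracket_constField he.1 hx, map_zero, sub_zero] at h
  have h2 := congrArg (F.coeff e x) (sub_eq_zero.1 h)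
  rw [hG.coeff_toFun_toFun he hx hGd, hG.coeff_toFun_toFun he hx hGd] at h2
  rw [add_comm, h2, add_comm]

/-- Changing the transverse coordinates to affine coordinates of the Christoffel symbols gives an
affine chart. -/
theorem HasChristoffel.isAffineChart_transChart (hG : D.HasChristoffel e G) (he : F.IsAdapted e)
    {φ : OpenPartialHomeomorph (EuclideanSpace ℝ (Fin q)) (EuclideanSpace ℝ (Fin q))}
    (hφ : ContDiffOn ℝ ∞ φ φ.source) (hφ' : ContDiffOn ℝ ∞ φ.symm φ.target)
    {P : EuclideanSpace ℝ (Fin q) → EuclideanSpace ℝ (Fin q) →L[ℝ] EuclideanSpace ℝ (Fin q)}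
    (hP : ∀ y ∈ φ.source, HasFDerivAt φ (P y) y ∧ Function.Injective (P y) ∧
      HasFDerivAt P ((ContinuousLinearMap.compL ℝ _ _ _ (P y)).comp (G y)) y) :
    D.IsAffineChart (transChart e φ) := by
  have hatlas := transChart_mem_maximalAtlas he.1 hφ hφ'
  have hsnd : ∀ z ∈ (transChart e φ).source, ∀ v : TangentSpace (folI p q) z,
      (mfderiv (folI p q) (folI p q) (transChart e φ) z v : FolModel p q).2 =
      P (e z).2 (mfderiv (folI p q) (folI p q) e z v : FolModel p q).2 := fun z hz v =>
    mfderiv_transChart_snd he.1 hatlas hz (hP _ (mem_transChart_source.1 hz).2).1 v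
  have hadapt : F.IsAdapted (transChart e φ) := by
    refine ⟨hatlas, fun z hz => ?_⟩
    have hz' := mem_transChart_source.1 hz
    ext v
    rw [he.mem_tangent_iff hz'.1, LinearMap.mem_ker, transDiff_apply hatlas hz, hsnd z hz]
    exact (map_eq_zero_iff _ (hP _ hz'.2).2.1).symm
  refine ⟨hadapt, fun z hz i v => ?_⟩
  have hz' := mem_transChart_source.1 hz
  set s := F.coordSection (transChart e φ) i with hsdef
  have hs : F.IsSmoothOn s (transChart e φ).source := isSmoothOn_constSection hadapt _
  have hco : ∀ z ∈ (transChart e φ).source,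
      P (e z).2 (F.coeff e z (s z)) = EuclideanSpace.single i 1 := by
    intro z hz
    rw [hsdef, coordSection_eq_constSection, constSection,
      coeff_bar he (mem_transChart_source.1 hz).1, ← hsnd z hz, mfderiv_constField hatlas hz]
  apply coeff_injective he hz'.1
  -- As `P` is injective, it suffices that `P` kills the components of `D s`. By `dP = P ∘ G` these
  -- become the derivative of `P` applied to the components of `s`, a product that is constant by
  -- `hco`.
  apply (hP _ hz'.2).2.1
  rw [map_zero, map_zero, hG.coeff_toFun he (transChart e φ).open_source hs hz hz'.1, map_add]
  have hQ := ((hs.contDiffAt_coeffIn (transChart e φ).open_source he hz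
    hz'.1).differentiableAt (by simp)).hasFDerivAt
  have hPd : HasFDerivAt (fun w : FolModel p q => P w.2) _ (e z) :=
    HasFDerivAt.comp (g := P) (f := Prod.snd) (e z) (hP _ hz'.2).2.2 hasFDerivAt_snd
  have hprod : HasFDerivAt (fun w : FolModel p q => P w.2 (F.coeffIn e s w)) _ (e z) :=
    hPd.clm_apply hQ
  have hconst : (fun w : FolModel p q => P w.2 (F.coeffIn e s w)) =ᶠ[𝓝 (e z)]
      fun _ => EuclideanSpace.single i 1 := by
    have hc := (e.continuousAt_symm (e.map_source hz'.1)).preimage_mem_nhds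
      (by rw [e.left_inv hz'.1]; exact (transChart e φ).open_source.mem_nhds hz)
    filter_upwards [hc, e.open_target.mem_nhds (e.map_source hz'.1)] with w hw hwt
    have := hco _ hw
    rwa [e.right_inv hwt] at this
  have h0 := hprod.unique ((hasFDerivAt_const _ _).congr_of_eventuallyEq hconst)
  have h1 := congrArg (fun L : FolModel p q →L[ℝ] EuclideanSpace ℝ (Fin q) =>
    L (mfderiv (folI p q) (folI p q) e z v)) h0
  have hz0 : F.coeffIn e s (e z) = F.coeff e z (s z) := by rw [coeffIn, e.left_inv hz'.1]
  simp only [hz0] at h1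
  rw [add_comm]
  exact h1

end Christoffel

/-- A foliated flat connection admits affine adapted charts. -/
theorem exists_isAffineChart (hD : D.IsFoliated) (hflat : D.IsFlat) (x : M) :
    ∃ e, D.IsAffineChart e ∧ x ∈ e.source := by
  obtain ⟨e₀, hx₀, he₀⟩ := F.exists_adapted x
  obtain ⟨S, hS, hx, -, r, hr, ht⟩ :=
    exists_restrOpen_target_eq_ball e₀ hx₀ isOpen_univ (Set.mem_univ x)
  have he := IsAdapted.restrOpen (F := F) he₀ hS
  generalize e₀.restrOpen S hS = e at hx ht he
  generalize e₀ x = c at ht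
  obtain ⟨G, hGs, hG⟩ := hD.exists_christoffel he ht
  replace hG : D.HasChristoffel e G := hG
  have hpt : ∀ y ∈ Metric.ball c.2 r, ∃ z ∈ e.source, (e z).2 = y := fun y hy => by
    have hw : ((c.1, y) : FolModel p q) ∈ e.target := by rw [ht]; exact mem_ball_transversal hy
    exact ⟨_, e.map_target hw, by rw [e.right_inv hw]⟩
  have hsymm : ∀ y ∈ Metric.ball c.2 r, ∀ a b, G y a b = G y b a := by
    intro y hy
    obtain ⟨z, hz, rfl⟩ := hpt y hy
    exact hG.symm hflat.1 he hz
  have hcurv : ∀ y ∈ Metric.ball c.2 r, ∀ a b f, fderiv ℝ G y a b f + G y a (G y b f) =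
      fderiv ℝ G y b a f + G y b (G y a f) := by
    intro y hy
    have hGd := (hGs.contDiffAt (Metric.isOpen_ball.mem_nhds hy)).differentiableAt (by simp)
    obtain ⟨z, hz, rfl⟩ := hpt y hy
    exact hG.curvature hflat.2 he hz hGd
  have hex : (e x).2 ∈ Metric.ball c.2 r := by
    have := e.map_source hx
    rw [ht] at this
    exact (mem_ball_iff_prod.1 this).2
  obtain ⟨φ, hφx, -, hφs, hφs', P, hP⟩ :=
    exists_affine_coordinates Metric.isOpen_ball hGs hsymm hcurv hex
  exact ⟨transChart e φ, hG.isAffineChart_transChart he hφs hφs' hP,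
    mem_transChart_source.2 ⟨hx, hφx⟩⟩

end NormalConnection

end Foliation

end

/-! ### The equivalences -/

theorem mainTheorem1 {p q : ℕ} {M : Type*} [TopologicalSpace M] [T2Space M]
    [ChartedSpace (FolModel p q) M] [IsManifold (folI p q) ∞ M]
    (F : Foliation p q M)
    (D : F.NormalConnection) (hDfol : D.IsFoliated) (hDflat : D.IsFlat)
    (g : F.NormalMetric) (hg : g.IsFoliated)
    (nabla : F.NormalConnection) (hnabla : nabla.IsLeviCivita g) :
    (∀ e : OpenPartialHomeomorph M (FolModel p q), F.IsAdapted e →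
      List.TFAE [
        D.HessianOn g e.source,
        D.CodazziOn g e.source,
        nabla.GamSelfAdjointOn D g e.source,
        nabla.GamLowerSymm D g e]) ∧
    (∀ e : OpenPartialHomeomorph M (FolModel p q), D.IsAffineChart e →
      List.TFAE [
        D.HessianOn g e.source,
        D.CodazziOn g e.source,
        Foliation.NormalConnection.DerivSymm g e,
        nabla.GamSelfAdjointOn D g e.source,
        nabla.GamLowerSymm D g e]) ∧
    List.TFAE [
      D.HessianOn g Set.univ,
      D.CodazziOn g Set.univ,
      ∀ e : OpenPartialHomeomorph M (FolModel p q), D.IsAffineChart e →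
        Foliation.NormalConnection.DerivSymm g e,
      nabla.GamSelfAdjointOn D g Set.univ,
      ∀ e : OpenPartialHomeomorph M (FolModel p q), F.IsAdapted e →
        nabla.GamLowerSymm D g e] := by
  choose B hB using Foliation.NormalConnection.exists_gam_tensor (D := D) (nabla := nabla)
    hDflat.1 hnabla.1
  have hB : Foliation.NormalConnection.IsGamTensor nabla D B := hB
  have hHess : ∀ W : Set M, IsOpen W →
      (D.HessianOn g W ↔ ∀ x ∈ W, Foliation.NormalConnection.CodazziAt g B x) := fun W hW =>
    ⟨fun h x hx => Foliation.NormalConnection.codazziAt_of_hessianOn hnabla hB h hx,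
      Foliation.NormalConnection.hessianOn_of_codazziAt hg hnabla hB
        (Foliation.NormalConnection.exists_isAffineChart hDfol hDflat) hW⟩
  have hCod := fun (W : Set M) (hW : IsOpen W) =>
    Foliation.NormalConnection.codazziOn_iff hnabla hB hW
  have hGam := fun (W : Set M) (hW : IsOpen W) =>
    Foliation.NormalConnection.gamSelfAdjointOn_iff (g := g) hB hW
  refine ⟨fun e he => ?_, fun e he => ?_, ?_⟩
  · rw [hHess _ e.open_source, hCod _ e.open_source, hGam _ e.open_source,
      Foliation.NormalConnection.gamLowerSymm_iff hB he]
    simp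
  · rw [hHess _ e.open_source, hCod _ e.open_source, hGam _ e.open_source,
      Foliation.NormalConnection.gamLowerSymm_iff hB he.1,
      Foliation.NormalConnection.derivSymm_iff hnabla hB he]
    simp
  -- The chartwise conditions become global ones because affine charts, respectively adapted charts
  -- in `h2`, cover `M` and the symmetry is pointwise.
  · have h1 : (∀ e : OpenPartialHomeomorph M (FolModel p q), D.IsAffineChart e →
        Foliation.NormalConnection.DerivSymm g e) ↔
        ∀ x ∈ Set.univ, Foliation.NormalConnection.CodazziAt g B x := by
      refine ⟨fun h x _ => ?_, fun h e he =>
        (Foliation.NormalConnection.derivSymm_iff hnabla hB he).2 fun x _ => h x trivial⟩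
      obtain ⟨e, he, hx⟩ := Foliation.NormalConnection.exists_isAffineChart hDfol hDflat x
      exact (Foliation.NormalConnection.derivSymm_iff hnabla hB he).1 (h e he) x hx
    have h2 : (∀ e : OpenPartialHomeomorph M (FolModel p q), F.IsAdapted e →
        nabla.GamLowerSymm D g e) ↔
        ∀ x ∈ Set.univ, Foliation.NormalConnection.CodazziAt g B x := by
      refine ⟨fun h x _ => ?_, fun h e he =>
        (Foliation.NormalConnection.gamLowerSymm_iff hB he).2 fun x _ => h x trivial⟩
      obtain ⟨e, hx, he⟩ := F.exists_adapted x
      exact (Foliation.NormalConnection.gamLowerSymm_iff hB he).1 (h e he) x hx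
    rw [hHess _ isOpen_univ, hCod _ isOpen_univ, hGam _ isOpen_univ, h1, h2]
    simp
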